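/- Theorem (inner bound for the interference channel with confidential messages). Consider a discrete memoryless interference channel with finite input alphabets $\mathcal X_1,\mathcal X_2$, finite output alphabets $\mathcal Y_1,\mathcal Y_2$ and transition probability $P(y_1,y_2|x_1,x_2)$. A code of block length $n\ge 1$ with $M_1,M_2$ messages consists of two stochastic encoders, i.e. conditional probability distributions $f_t(\mathbf x_t|w_t)$ on $\mathcal X_t^n$ for $w_t\in\{1,\dots,M_t\}$, and two decoders $\psi_t:\mathcal Y_t^n\to\{1,\dots,M_t\}$, $t=1,2$. The messages $W_1,W_2$ are independent and uniform, $\mathbf Y_1,\mathbf Y_2$ are the channel outputs, $P_{e,t}$ is the error probability of decoder $t$ averaged over the message pairs, and $P_e=\max\{P_{e,1},P_{e,2}\}$. All logarithms are to base 2. A pair of rates $R_1,R_2\ge 0$ is achievable (under weak secrecy) if for every $\epsilon_0>0$ there is a code, of some block length $n\ge1$, with $$M_t\ge 2^{nR_t}\ (t=1,2),\qquad P_e\le\epsilon_0,\qquad nR_1-H(W_1|\mathbf Y_2)\le n\epsilon_0,\qquad nR_2-H(W_2|\mathbf Y_1)\le n\epsilon_0 .$$ The capacity region is the closure of the set of achievable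 rate pairs. Let $U,V_1,V_2$ be auxiliary random variables with finite alphabets such that $(U,V_1,V_2,X_1,X_2,Y_1,Y_2)$ has a joint distribution of the form $$P(u)P(v_1|u)P(v_2|u)P(x_1|v_1)P(x_2|v_2)P(y_1,y_2|x_1,x_2),$$ and let $$0\le R_1\le I(V_1;Y_1|U)-I(V_1;Y_2|V_2,U),\qquad 0\le R_2\le I(V_2;Y_2|U)-I(V_2;Y_1|V_1,U).$$ Then $(R_1,R_2)$ belongs to the capacity region. Moreover, $(R_1,R_2)$ is itself achievable provided that, for each $t\in\{1,2\}$, $R_t=0$ or $R_t<I(V_t;Y_t|U)$ (when $R_t>0$, this excludes only the case where $R_t$ attains its upper bound and the subtracted secrecy penalty is zero). -/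

import Mathlib

namespace ICCM

open Classical in
/-- The distribution `a ↦ P[X = a]` of a random variable `X : Ω → α` on a finite sample space
with probability mass function `p`. -/
noncomputable def law {Ω α : Type*} [Fintype Ω] (p : Ω → ℝ) (X : Ω → α) (a : α) : ℝ :=
  ∑ ω, if X ω = a then p ω else 0

/-- Conditional Shannon entropy in bits:
`H(X|Y) = - ∑_{x,y} p(x,y) log₂ p(x|y)`, with `0 log 0 = 0`. -/
noncomputable def condEntropy {Ω α β : Type*} [Fintype Ω] [Fintype α] [Fintype β]
    (p : Ω → ℝ) (X : Ω → α) (Y : Ω → β) : ℝ :=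
  -∑ x, ∑ y, law p (fun ω => (X ω, Y ω)) (x, y) *
      Real.logb 2 (law p (fun ω => (X ω, Y ω)) (x, y) / law p Y y)

/-- Conditional mutual information in bits: `I(X;Y|Z) = H(X|Z) - H(X|Y,Z)`. -/
noncomputable def condMutualInfo {Ω α β γ : Type*} [Fintype Ω] [Fintype α] [Fintype β] [Fintype γ]
    (p : Ω → ℝ) (X : Ω → α) (Y : Ω → β) (Z : Ω → γ) : ℝ :=
  condEntropy p X Z - condEntropy p X (fun ω => (Y ω, Z ω))

section Channel

variable {X₁ X₂ Y₁ Y₂ : Type*} [Fintype X₁] [Fintype X₂] [Fintype Y₁] [Fintype Y₂]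

/-- `W x₁ x₂ (y₁, y₂) = P(y₁, y₂ | x₁, x₂)` is a transition probability. -/
def IsChannel (W : X₁ → X₂ → Y₁ × Y₂ → ℝ) : Prop :=
  ∀ x₁ x₂, W x₁ x₂ ∈ stdSimplex ℝ (Y₁ × Y₂)

/-- A code of block length `n` with `M₁` and `M₂` messages: two stochastic encoders
`f_t(x_t | w_t)` and two decoders. -/
structure Code (X₁ X₂ Y₁ Y₂ : Type*) [Fintype X₁] [Fintype X₂] (n M₁ M₂ : ℕ) where
  f₁ : Fin M₁ → (Fin n → X₁) → ℝ
  f₂ : Fin M₂ → (Fin n → X₂) → ℝ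
  f₁_mem : ∀ w, f₁ w ∈ stdSimplex ℝ (Fin n → X₁)
  f₂_mem : ∀ w, f₂ w ∈ stdSimplex ℝ (Fin n → X₂)
  ψ₁ : (Fin n → Y₁) → Fin M₁
  ψ₂ : (Fin n → Y₂) → Fin M₂

namespace Code

variable {n M₁ M₂ : ℕ}

/-- The probability of the output sequences `(y₁, y₂)` when the messages `(w₁, w₂)` are sent
over the memoryless channel `W`. -/
noncomputable def outputLaw (W : X₁ → X₂ → Y₁ × Y₂ → ℝ) (c : Code X₁ X₂ Y₁ Y₂ n M₁ M₂)
    (w₁ : Fin M₁) (w₂ : Fin M₂) (y₁ : Fin n → Y₁) (y₂ : Fin n → Y₂) : ℝ :=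
  ∑ x₁, ∑ x₂, c.f₁ w₁ x₁ * c.f₂ w₂ x₂ * ∏ i, W (x₁ i) (x₂ i) (y₁ i, y₂ i)

open Classical in
/-- Average error probability of receiver 1. -/
noncomputable def error₁ (W : X₁ → X₂ → Y₁ × Y₂ → ℝ) (c : Code X₁ X₂ Y₁ Y₂ n M₁ M₂) : ℝ :=
  ∑ w₁, ∑ w₂, 1 / ((M₁ : ℝ) * (M₂ : ℝ)) *
    ∑ y₁, ∑ y₂, if c.ψ₁ y₁ ≠ w₁ then c.outputLaw W w₁ w₂ y₁ y₂ else 0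

open Classical in
/-- Average error probability of receiver 2. -/
noncomputable def error₂ (W : X₁ → X₂ → Y₁ × Y₂ → ℝ) (c : Code X₁ X₂ Y₁ Y₂ n M₁ M₂) : ℝ :=
  ∑ w₁, ∑ w₂, 1 / ((M₁ : ℝ) * (M₂ : ℝ)) *
    ∑ y₁, ∑ y₂, if c.ψ₂ y₂ ≠ w₂ then c.outputLaw W w₁ w₂ y₁ y₂ else 0

/-- The larger of the two average error probabilities. -/
noncomputable def error (W : X₁ → X₂ → Y₁ × Y₂ → ℝ) (c : Code X₁ X₂ Y₁ Y₂ n M₁ M₂) : ℝ :=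
  max (c.error₁ W) (c.error₂ W)

/-- The joint distribution of `(W₁, W₂, Y₁ⁿ, Y₂ⁿ)` for independent uniform messages. -/
noncomputable def jointLaw (W : X₁ → X₂ → Y₁ × Y₂ → ℝ) (c : Code X₁ X₂ Y₁ Y₂ n M₁ M₂)
    (ω : Fin M₁ × Fin M₂ × (Fin n → Y₁) × (Fin n → Y₂)) : ℝ :=
  1 / ((M₁ : ℝ) * (M₂ : ℝ)) * c.outputLaw W ω.1 ω.2.1 ω.2.2.1 ω.2.2.2

/-- `H(W₁ | Y₂ⁿ)` in bits. -/
noncomputable def equivocation₁ (W : X₁ → X₂ → Y₁ × Y₂ → ℝ)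
    (c : Code X₁ X₂ Y₁ Y₂ n M₁ M₂) : ℝ :=
  condEntropy (c.jointLaw W) (fun ω => ω.1) (fun ω => ω.2.2.2)

/-- `H(W₂ | Y₁ⁿ)` in bits. -/
noncomputable def equivocation₂ (W : X₁ → X₂ → Y₁ × Y₂ → ℝ)
    (c : Code X₁ X₂ Y₁ Y₂ n M₁ M₂) : ℝ :=
  condEntropy (c.jointLaw W) (fun ω => ω.2.1) (fun ω => ω.2.2.1)

end Code

/-- A pair of nonnegative rates is achievable (under weak secrecy) if for every `ε > 0` some code
of positive block length carries these rates, is `ε`-reliable, and has equivocation rates within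
`ε` of the message rates. -/
def IsAchievable (W : X₁ → X₂ → Y₁ × Y₂ → ℝ) (R₁ R₂ : ℝ) : Prop :=
  0 ≤ R₁ ∧ 0 ≤ R₂ ∧
    ∀ ε : ℝ, 0 < ε → ∃ (n M₁ M₂ : ℕ) (c : Code X₁ X₂ Y₁ Y₂ n M₁ M₂),
      1 ≤ n ∧
      (2 : ℝ) ^ ((n : ℝ) * R₁) ≤ (M₁ : ℝ) ∧
      (2 : ℝ) ^ ((n : ℝ) * R₂) ≤ (M₂ : ℝ) ∧
      c.error W ≤ ε ∧
      (n : ℝ) * R₁ - c.equivocation₁ W ≤ (n : ℝ) * ε ∧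
      (n : ℝ) * R₂ - c.equivocation₂ W ≤ (n : ℝ) * ε

/-- The capacity region: the closure of the set of achievable rate pairs. -/
def capacityRegion (W : X₁ → X₂ → Y₁ × Y₂ → ℝ) : Set (ℝ × ℝ) :=
  closure {R : ℝ × ℝ | IsAchievable W R.1 R.2}

/-- The joint distributions `P(u, v₁, v₂, x₁, x₂, y₁, y₂)` that factor as
`P(u) P(v₁|u) P(v₂|u) P(x₁|v₁) P(x₂|v₂) P(y₁,y₂|x₁,x₂)`, the last factor being the channel. -/
def inputClass (U V₁ V₂ : Type*) [Fintype U] [Fintype V₁] [Fintype V₂]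
    (W : X₁ → X₂ → Y₁ × Y₂ → ℝ) : Set (U × V₁ × V₂ × X₁ × X₂ × Y₁ × Y₂ → ℝ) :=
  {P | ∃ (pU : U → ℝ) (p₁ : U → V₁ → ℝ) (p₂ : U → V₂ → ℝ) (q₁ : V₁ → X₁ → ℝ) (q₂ : V₂ → X₂ → ℝ),
    pU ∈ stdSimplex ℝ U ∧
    (∀ u, p₁ u ∈ stdSimplex ℝ V₁) ∧ (∀ u, p₂ u ∈ stdSimplex ℝ V₂) ∧
    (∀ v, q₁ v ∈ stdSimplex ℝ X₁) ∧ (∀ v, q₂ v ∈ stdSimplex ℝ X₂) ∧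
    ∀ u v₁ v₂ x₁ x₂ y₁ y₂, P (u, v₁, v₂, x₁, x₂, y₁, y₂) =
      pU u * p₁ u v₁ * p₂ u v₂ * q₁ v₁ x₁ * q₂ v₂ x₂ * W x₁ x₂ (y₁, y₂)}

end Channel

section Coordinates

variable {X₁ X₂ Y₁ Y₂ U V₁ V₂ : Type*}

/-- The random variable `U`. -/
def rvU (ω : U × V₁ × V₂ × X₁ × X₂ × Y₁ × Y₂) : U := ω.1

/-- The random variable `V₁`. -/
def rvV₁ (ω : U × V₁ × V₂ × X₁ × X₂ × Y₁ × Y₂) : V₁ := ω.2.1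

/-- The random variable `V₂`. -/
def rvV₂ (ω : U × V₁ × V₂ × X₁ × X₂ × Y₁ × Y₂) : V₂ := ω.2.2.1

/-- The random variable `Y₁`. -/
def rvY₁ (ω : U × V₁ × V₂ × X₁ × X₂ × Y₁ × Y₂) : Y₁ := ω.2.2.2.2.2.1

/-- The random variable `Y₂`. -/
def rvY₂ (ω : U × V₁ × V₂ × X₁ × X₂ × Y₁ × Y₂) : Y₂ := ω.2.2.2.2.2.2

end Coordinates

end ICCM

/-!
The proof is by random coding, carried out with finite sums. A time-sharing sequence `u` and two
codebooks are drawn at random: given `u`, the codewords of user `t` are independent sequences with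
letters of law `P(v_t|u_i)`. User `t` has `M_t = ⌈2 ^ (n R_t)⌉` messages and reserves
`L_t = ⌈2 ^ (n (S_t - 2δ))⌉` codewords for each, where `S_t` is the subtracted secrecy penalty. The
encoder draws one of the codewords reserved for the message and sends it through the prefix channel
`P(x_t|v_t)`.

*Reliability.* Averaging over the codebook of the interfering user turns its codeword into noise
which is independent from letter to letter, so a receiver faces the memoryless channel
`P(y_t|v_t,u)`. A threshold test on the likelihood ratio `P(yⁿ|vⁿ,uⁿ) / P(yⁿ|uⁿ)` finds the codeword
if `M_t L_t - 1` is exponentially smaller than `2 ^ (n I(V_t;Y_t|U))` (`sum_error_le`,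
`codebookMean_error_le`). The total rate `R_t + S_t - 2δ` leaves the necessary gap even when `R_t`
attains its upper bound; only for `S_t = 0`, where `L_t = 1`, does `R_t < I(V_t;Y_t|U)` have to be
asked for (`exists_codebook_size_le`).

*Secrecy.* The leakage `log₂ M - H(W|Y)` about a message to the other receiver is at most the mean
divergence, given the interfering codeword, between the output of the `L` codewords of the message
and the output of the random coding law (`logb_sub_condEntropy_le`). The mean of this divergence
over the codebooks is at most the mean of `log₂ (1 + 2 ^ i / L)`, where `i` is the information
density of the block (`sum_mixtureDivergence_le`); since `i` concentrates at `n S_t`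
(`sum_logb_one_add_le`), this is at most `3 n δ` for large `n`. No decoding argument for the
eavesdropping receiver is involved, and the bound remains meaningful for `L` slightly below the
resolvability threshold because leakage is only measured as a rate.

Error probabilities and leakages are nonnegative, so a pair of codebooks for which their sum does not
exceed its mean makes all four of them small. Finally, scaling the rates down strictly brings every
pair of the region below the excluded boundary, since `S_t ≥ 0`; this gives the closure.
-/

namespace ICCM

/-! ### Product laws and their moments -/

/-- The probability of the sequence `a` when its letters are independent, the `i`-th one with
law `p i`. With `ι = Fin n` this is the law of a block; with `ι` the index set of a codebook and
`α` a set of blocks it is the law of a random codebook. -/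
noncomputable def productLaw {ι α : Type*} [Fintype ι] (p : ι → α → ℝ) (a : ι → α) : ℝ :=
  ∏ i, p i (a i)

lemma productLaw_nonneg {ι α : Type*} [Fintype ι] {p : ι → α → ℝ} (hp : ∀ i a, 0 ≤ p i a)
    (a : ι → α) : 0 ≤ productLaw p a :=
  Finset.prod_nonneg fun i _ => hp i (a i)

/-- A sum over sequences of pairs is a sum over pairs of sequences. -/
lemma sum_arrow_prod {ι α β : Type*} [Fintype ι] [DecidableEq ι] [Fintype α] [Fintype β]
    (F : (ι → α) → (ι → β) → ℝ) :
    ∑ ω : ι → α × β, F (fun i => (ω i).1) (fun i => (ω i).2) = ∑ a, ∑ b, F a b := by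
  rw [← Fintype.sum_prod_type']
  exact Fintype.sum_equiv (Equiv.arrowProdEquivProdArrow ι (fun _ => α) (fun _ => β)) _ _
    fun _ => rfl

section ProductLaw

variable {ι α : Type*} [Fintype ι] [DecidableEq ι] [Fintype α]

lemma sum_productLaw (f : ι → α → ℝ) : ∑ a, productLaw f a = ∏ i, ∑ x, f i x := by
  classical
  simp only [productLaw]
  rw [Finset.prod_univ_sum, Fintype.piFinset_univ]

lemma productLaw_mem {p : ι → α → ℝ} (hp : ∀ i, p i ∈ stdSimplex ℝ α) :
    productLaw p ∈ stdSimplex ℝ (ι → α) := by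
  refine ⟨productLaw_nonneg fun i => (hp i).1, ?_⟩
  rw [sum_productLaw]
  exact Finset.prod_eq_one fun i _ => (hp i).2

/-- The joint law of two distinct letters of an independent sequence is the product law. -/
lemma sum_productLaw_pair {p : ι → α → ℝ} (hp : ∀ i, ∑ x, p i x = 1) {j k : ι} (hjk : j ≠ k)
    (F : α → α → ℝ) :
    ∑ a, productLaw p a * F (a j) (a k) = ∑ x, p j x * ∑ y, p k y * F x y := by
  classical
  have key : ∀ x y, ∑ a, productLaw p a * ((if a j = x then 1 else 0) * (if a k = y then 1 else 0))
      = p j x * p k y := by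
    intro x y
    have h1 : ∀ a : ι → α,
        productLaw p a * ((if a j = x then 1 else 0) * (if a k = y then 1 else 0)) =
        productLaw (fun i z => p i z * ((if i = j then (if z = x then 1 else 0) else 1) *
          (if i = k then (if z = y then 1 else 0) else 1))) a := by
      intro a
      simp only [productLaw, Finset.prod_mul_distrib]
      simp
    rw [Finset.sum_congr rfl fun a _ => h1 a, sum_productLaw,
      ← Finset.mul_prod_erase _ _ (Finset.mem_univ j),
      ← Finset.mul_prod_erase _ _ (Finset.mem_erase.2 ⟨hjk.symm, Finset.mem_univ k⟩),
      Finset.prod_eq_one]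
    · simp [hjk, hjk.symm]
    · intro i hi
      simp only [Finset.mem_erase] at hi
      simp [hi.1, hi.2.1, hp]
  have h2 : ∀ a : ι → α, productLaw p a * F (a j) (a k) = ∑ x, ∑ y,
      productLaw p a * ((if a j = x then 1 else 0) * (if a k = y then 1 else 0)) * F x y := by
    intro a
    simp
  rw [Finset.sum_congr rfl fun a _ => h2 a, Finset.sum_comm]
  refine Finset.sum_congr rfl fun x _ => ?_
  rw [Finset.sum_comm, Finset.mul_sum]
  refine Finset.sum_congr rfl fun y _ => ?_
  rw [← Finset.sum_mul, key]
  ring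

lemma sum_productLaw_single {p : ι → α → ℝ} (hp : ∀ i, ∑ x, p i x = 1) (j : ι) (F : α → ℝ) :
    ∑ a, productLaw p a * F (a j) = ∑ x, p j x * F x := by
  classical
  have key : ∀ x, ∑ a, productLaw p a * (if a j = x then 1 else 0) = p j x := by
    intro x
    have h1 : ∀ a : ι → α, productLaw p a * (if a j = x then 1 else 0) =
        productLaw (fun i z => p i z * (if i = j then (if z = x then 1 else 0) else 1)) a := by
      intro a
      simp only [productLaw, Finset.prod_mul_distrib]
      simp
    rw [Finset.sum_congr rfl fun a _ => h1 a, sum_productLaw,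
      ← Finset.mul_prod_erase _ _ (Finset.mem_univ j), Finset.prod_eq_one]
    · simp
    · intro i hi
      simp only [Finset.mem_erase] at hi
      simp [hi.1, hp]
  have h2 : ∀ a : ι → α, productLaw p a * F (a j) = ∑ x,
      productLaw p a * (if a j = x then 1 else 0) * F x := by
    intro a
    simp
  rw [Finset.sum_congr rfl fun a _ => h2 a, Finset.sum_comm]
  refine Finset.sum_congr rfl fun x _ => ?_
  rw [← Finset.sum_mul, key]

/-- The variance of a sum of independent identically distributed centred letters. -/
lemma sum_productLaw_sq {P : α → ℝ} (hP : ∑ x, P x = 1) {g : α → ℝ} (hg : ∑ x, P x * g x = 0) :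
    ∑ a : ι → α, productLaw (fun _ => P) a * (∑ i, g (a i)) ^ 2 =
      Fintype.card ι * ∑ x, P x * g x ^ 2 := by
  classical
  have h1 : ∀ a : ι → α, productLaw (fun _ => P) a * (∑ i, g (a i)) ^ 2 =
      ∑ i, ∑ j, productLaw (fun _ => P) a * (g (a i) * g (a j)) := by
    intro a
    rw [sq, Finset.sum_mul_sum, Finset.mul_sum]
    exact Finset.sum_congr rfl fun i _ => Finset.mul_sum _ _ _
  rw [Finset.sum_congr rfl fun a _ => h1 a, Finset.sum_comm]
  have h2 : ∀ i : ι, ∑ a : ι → α, ∑ j, productLaw (fun _ => P) a * (g (a i) * g (a j)) =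
      ∑ x, P x * g x ^ 2 := by
    intro i
    rw [Finset.sum_comm, Finset.sum_eq_single i]
    · rw [sum_productLaw_single (p := fun _ : ι => P) (fun _ => hP) i fun x => g x * g x]
      simp [sq]
    · intro j _ hj
      rw [sum_productLaw_pair (p := fun _ : ι => P) (fun _ => hP) hj.symm fun x y => g x * g y]
      refine Finset.sum_eq_zero fun x _ => ?_
      have : ∑ y, P y * (g x * g y) = g x * ∑ y, P y * g y := by
        rw [Finset.mul_sum]
        exact Finset.sum_congr rfl fun y _ => by ring
      rw [this, hg]
      simp
    · simp
  simp [h2]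

end ProductLaw

/-! ### The Gibbs inequality -/

/-- Nonnegativity of the divergence between a finite measure `a` and a dominating measure `b` of
no larger mass, in bits. -/
lemma gibbs_inequality {ι : Type*} [Fintype ι] {a b : ι → ℝ} (ha : ∀ i, 0 ≤ a i)
    (hb : ∀ i, 0 ≤ b i) (hab : ∀ i, b i = 0 → a i = 0) (hsum : ∑ i, b i ≤ ∑ i, a i) :
    0 ≤ ∑ i, a i * Real.logb 2 (a i / b i) := by
  have hl2 : 0 < Real.log 2 := Real.log_pos one_lt_two
  have h : ∀ i, (a i - b i) / Real.log 2 ≤ a i * Real.logb 2 (a i / b i) := by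
    intro i
    rcases (ha i).eq_or_lt with h0 | h0
    · rw [← h0]
      have := div_nonneg (hb i) hl2.le
      simp only [zero_sub, zero_mul, neg_div]
      linarith
    · have hb0 : 0 < b i := (hb i).lt_of_ne fun h => h0.ne' (hab i h.symm)
      have h1 := Real.one_sub_inv_le_log_of_pos (div_pos h0 hb0)
      rw [Real.logb, ← mul_div_assoc]
      refine div_le_div_of_nonneg_right ?_ hl2.le
      have h2 : a i * (1 - (a i / b i)⁻¹) = a i - b i := by
        field_simp
      rw [← h2]
      exact mul_le_mul_of_nonneg_left h1 h0.le
  refine le_trans ?_ (Finset.sum_le_sum fun i _ => h i)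
  rw [← Finset.sum_div, Finset.sum_sub_distrib]
  exact div_nonneg (by linarith) hl2.le

/-! ### Information densities of channels with state -/

section StateChannel

variable {S V Y : Type*} [Fintype V] [Fintype Y]

/-- The output law `P(y|s) = ∑ P(v|s) P(y|v,s)` of the channel `B`, whose state `s` is known, when
the input law is `p`. -/
noncomputable def outLaw (p : S → V → ℝ) (B : S → V → Y → ℝ) (s : S) (y : Y) : ℝ :=
  ∑ v, p s v * B s v y

/-- The joint law `P(s) P(v|s) P(y|v,s)` of state, input and output. -/
noncomputable def stateLaw (π : S → ℝ) (p : S → V → ℝ) (B : S → V → Y → ℝ) (t : S × V × Y) : ℝ :=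
  π t.1 * p t.1 t.2.1 * B t.1 t.2.1 t.2.2

/-- The information density `log₂ (P(y|v,s) / P(y|s))`. -/
noncomputable def infoDensity (p : S → V → ℝ) (B : S → V → Y → ℝ) (t : S × V × Y) : ℝ :=
  Real.logb 2 (B t.1 t.2.1 t.2.2 / outLaw p B t.1 t.2.2)

/-- The mean of the information density, which is `I(V;Y|S)`. -/
noncomputable def meanInfo [Fintype S] (π : S → ℝ) (p : S → V → ℝ) (B : S → V → Y → ℝ) : ℝ :=
  ∑ t, stateLaw π p B t * infoDensity p B t

/-- The variance of the information density. -/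
noncomputable def varInfo [Fintype S] (π : S → ℝ) (p : S → V → ℝ) (B : S → V → Y → ℝ) : ℝ :=
  ∑ t, stateLaw π p B t * (infoDensity p B t - meanInfo π p B) ^ 2

variable {π : S → ℝ} {p : S → V → ℝ} {B : S → V → Y → ℝ}

lemma outLaw_mem (hp : ∀ s, p s ∈ stdSimplex ℝ V) (hB : ∀ s v, B s v ∈ stdSimplex ℝ Y) (s : S) :
    outLaw p B s ∈ stdSimplex ℝ Y := by
  refine ⟨fun y => Finset.sum_nonneg fun v _ => mul_nonneg ((hp s).1 v) ((hB s v).1 y), ?_⟩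
  simp only [outLaw]
  rw [Finset.sum_comm]
  simp [← Finset.mul_sum, (hB s _).2, (hp s).2]

lemma mul_eq_zero_of_outLaw_eq_zero (hp : ∀ s, p s ∈ stdSimplex ℝ V)
    (hB : ∀ s v, B s v ∈ stdSimplex ℝ Y) {s : S} {y : Y} (h : outLaw p B s y = 0) (v : V) :
    p s v * B s v y = 0 :=
  (Finset.sum_eq_zero_iff_of_nonneg
    fun v _ => mul_nonneg ((hp s).1 v) ((hB s v).1 y)).1 h v (Finset.mem_univ v)

lemma mul_mem_stdSimplex {U V : Type*} [Fintype U] [Fintype V] {π : U → ℝ} (hπ : π ∈ stdSimplex ℝ U) {p : U → V → ℝ}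
    (hp : ∀ u, p u ∈ stdSimplex ℝ V) :
    (fun s : V × U => π s.2 * p s.2 s.1) ∈ stdSimplex ℝ (V × U) := by
  refine ⟨fun s => mul_nonneg (hπ.1 _) ((hp _).1 _), ?_⟩
  rw [Fintype.sum_prod_type, Finset.sum_comm]
  simp [← Finset.mul_sum, (hp _).2, hπ.2]

lemma stateLaw_mem [Fintype S] (hπ : π ∈ stdSimplex ℝ S) (hp : ∀ s, p s ∈ stdSimplex ℝ V)
    (hB : ∀ s v, B s v ∈ stdSimplex ℝ Y) : stateLaw π p B ∈ stdSimplex ℝ (S × V × Y) := by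
  refine ⟨fun t => mul_nonneg (mul_nonneg (hπ.1 _) ((hp _).1 _)) ((hB _ _).1 _), ?_⟩
  simp [stateLaw, Fintype.sum_prod_type, ← Finset.mul_sum, (hB _ _).2, (hp _).2, hπ.2]

lemma meanInfo_nonneg [Fintype S] (hπ : π ∈ stdSimplex ℝ S) (hp : ∀ s, p s ∈ stdSimplex ℝ V)
    (hB : ∀ s v, B s v ∈ stdSimplex ℝ Y) : 0 ≤ meanInfo π p B := by
  have hJ := stateLaw_mem hπ hp hB
  have hq := outLaw_mem hp hB
  have := gibbs_inequality (a := stateLaw π p B)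
    (b := fun t => π t.1 * p t.1 t.2.1 * outLaw p B t.1 t.2.2) hJ.1
    (fun t => mul_nonneg (mul_nonneg (hπ.1 _) ((hp _).1 _)) ((hq _).1 _)) ?_ ?_
  · refine this.trans_eq (Finset.sum_congr rfl fun t _ => ?_)
    by_cases h : stateLaw π p B t = 0
    · simp [h]
    · have h' : π t.1 * p t.1 t.2.1 ≠ 0 := left_ne_zero_of_mul h
      rw [infoDensity, stateLaw, mul_div_mul_left _ _ h']
  · intro t h
    rcases mul_eq_zero.1 h with h | h
    · simp [stateLaw, h]
    · have := mul_eq_zero_of_outLaw_eq_zero hp hB h t.2.1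
      rw [stateLaw, mul_assoc, this, mul_zero]
  · rw [hJ.2]
    simp [Fintype.sum_prod_type, ← Finset.mul_sum, (hq _).2, (hp _).2, hπ.2]

end StateChannel

section Entropy

variable {Ω α β γ : Type*} [Fintype Ω]

lemma law_nonneg {P : Ω → ℝ} (hP : ∀ ω, 0 ≤ P ω) (X : Ω → α) (a : α) : 0 ≤ law P X a :=
  Finset.sum_nonneg fun ω _ => by split_ifs <;> simp [hP ω]

lemma sum_law [Fintype α] (P : Ω → ℝ) (X : Ω → α) : ∑ a, law P X a = ∑ ω, P ω := by
  classical
  simp only [law]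
  rw [Finset.sum_comm]
  simp

/-- Summing out the first component of a pair. -/
lemma sum_law_fst [Fintype α] (P : Ω → ℝ) (X : Ω → α) (Y : Ω → β) (b : β) :
    ∑ a, law P (fun ω => (X ω, Y ω)) (a, b) = law P Y b := by
  classical
  simp only [law]
  rw [Finset.sum_comm]
  refine Finset.sum_congr rfl fun ω _ => ?_
  simp [Prod.ext_iff, ite_and]

/-- Summing out the middle component of a triple. -/
lemma sum_law_mid [Fintype β] (P : Ω → ℝ) (X : Ω → α) (Y : Ω → β) (Z : Ω → γ) (a : α) (c : γ) :
    ∑ b, law P (fun ω => (X ω, (Y ω, Z ω))) (a, (b, c)) = law P (fun ω => (X ω, Z ω)) (a, c) := by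
  classical
  simp only [law]
  rw [Finset.sum_comm]
  refine Finset.sum_congr rfl fun ω _ => ?_
  simp only [Prod.ext_iff, ite_and]
  by_cases h : X ω = a <;> simp [h]

/-- If `(Z, X, Y)` has the law `P(s) P(v|s) P(y|v,s)`, then `I(X;Y|Z)` is the mean of the
information density. -/
lemma condMutualInfo_eq_meanInfo [Fintype α] [Fintype β] [Fintype γ] {P : Ω → ℝ} {X : Ω → α} {Y : Ω → β} {Z : Ω → γ} {π : γ → ℝ}
    {p : γ → α → ℝ} {B : γ → α → β → ℝ} (hp : ∀ s, p s ∈ stdSimplex ℝ α)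
    (hB : ∀ s v, B s v ∈ stdSimplex ℝ β)
    (h : ∀ s v y, law P (fun ω => (X ω, (Y ω, Z ω))) (v, (y, s)) = π s * p s v * B s v y) :
    condMutualInfo P X Y Z = meanInfo π p B := by
  have hXZ : ∀ v s, law P (fun ω => (X ω, Z ω)) (v, s) = π s * p s v := by
    intro v s
    rw [← sum_law_mid P X Y Z]
    simp [h, ← Finset.mul_sum, (hB _ _).2]
  have hZ : ∀ s, law P Z s = π s := by
    intro s
    rw [← sum_law_fst P X Z]
    simp [hXZ, ← Finset.mul_sum, (hp _).2]
  have hYZ : ∀ y s, law P (fun ω => (Y ω, Z ω)) (y, s) = π s * outLaw p B s y := by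
    intro y s
    rw [← sum_law_fst P X fun ω => (Y ω, Z ω)]
    simp only [h, outLaw, Finset.mul_sum]
    exact Finset.sum_congr rfl fun v _ => by ring
  have h1 : condEntropy P X Z =
      -∑ s, ∑ v, ∑ y, π s * p s v * B s v y * Real.logb 2 (π s * p s v / π s) := by
    rw [condEntropy, Finset.sum_comm]
    simp only [hXZ, hZ, ← Finset.sum_mul, ← Finset.mul_sum, (hB _ _).2, mul_one]
  have h2 : condEntropy P X (fun ω => (Y ω, Z ω)) =
      -∑ s, ∑ v, ∑ y, π s * p s v * B s v y *
        Real.logb 2 (π s * p s v * B s v y / (π s * outLaw p B s y)) := by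
    simp only [condEntropy, Fintype.sum_prod_type, h, hYZ]
    rw [neg_inj, Finset.sum_congr rfl fun v _ => Finset.sum_comm, Finset.sum_comm]
  rw [condMutualInfo, h1, h2, meanInfo, neg_sub_neg]
  simp only [Fintype.sum_prod_type, ← Finset.sum_sub_distrib]
  refine Finset.sum_congr rfl fun s _ => Finset.sum_congr rfl fun v _ =>
    Finset.sum_congr rfl fun y _ => ?_
  simp only [stateLaw, infoDensity]
  rw [← mul_sub]
  by_cases hJ : π s * p s v * B s v y = 0
  · simp [hJ]
  have hB0 := right_ne_zero_of_mul hJ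
  have hp0 := right_ne_zero_of_mul (left_ne_zero_of_mul hJ)
  have hπ0 := left_ne_zero_of_mul (left_ne_zero_of_mul hJ)
  have hq0 : outLaw p B s y ≠ 0 := fun h0 =>
    mul_ne_zero hp0 hB0 (mul_eq_zero_of_outLaw_eq_zero hp hB h0 v)
  congr 1
  rw [mul_assoc, mul_div_mul_left _ _ hπ0, mul_div_cancel_left₀ _ hπ0, mul_div_assoc,
    Real.logb_mul hp0 (div_ne_zero hB0 hq0), add_sub_cancel_left]

end Entropy

/-! ### Concentration of the information density of a block -/

section Block

variable {S V Y : Type*} [Fintype V] {n : ℕ}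
  {π : S → ℝ} {p : S → V → ℝ} {B : S → V → Y → ℝ}

/-- The output law of the memoryless extension is the product of the output laws. -/
lemma sum_productLaw_mul_productLaw (p : S → V → ℝ) (B : S → V → Y → ℝ) (s : Fin n → S)
    (y : Fin n → Y) :
    ∑ v, productLaw (fun i => p (s i)) v * productLaw (fun i => B (s i) (v i)) y =
      productLaw (fun i => outLaw p B (s i)) y := by
  have : ∀ v : Fin n → V, productLaw (fun i => p (s i)) v * productLaw (fun i => B (s i) (v i)) y =
      productLaw (fun i x => p (s i) x * B (s i) x (y i)) v := fun v => by
    simp [productLaw, Finset.prod_mul_distrib]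
  rw [Finset.sum_congr rfl fun v _ => this v, sum_productLaw]
  rfl

variable [Fintype Y]

/-- Sums over blocks of states, inputs and outputs against their joint law, as sums over blocks of
independent triples. -/
lemma sum_block [Fintype S] (π : S → ℝ) (p : S → V → ℝ) (B : S → V → Y → ℝ)
    (F : (Fin n → S) → (Fin n → V) → (Fin n → Y) → ℝ) :
    ∑ s, productLaw (fun _ => π) s * ∑ v, productLaw (fun i => p (s i)) v *
        ∑ y, productLaw (fun i => B (s i) (v i)) y * F s v y =
      ∑ ω : Fin n → S × V × Y, productLaw (fun _ => stateLaw π p B) ω *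
        F (fun i => (ω i).1) (fun i => (ω i).2.1) (fun i => (ω i).2.2) := by
  have h1 := sum_arrow_prod (ι := Fin n) (α := S) (β := V × Y) fun s vy =>
    productLaw (fun _ => stateLaw π p B) (fun i => (s i, vy i)) *
      F s (fun i => (vy i).1) (fun i => (vy i).2)
  rw [h1]
  refine Finset.sum_congr rfl fun s _ => ?_
  have h2 := sum_arrow_prod (ι := Fin n) (α := V) (β := Y) fun v y =>
    productLaw (fun _ => stateLaw π p B) (fun i => (s i, v i, y i)) * F s v y
  rw [h2, Finset.mul_sum]
  refine Finset.sum_congr rfl fun v _ => ?_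
  rw [Finset.mul_sum, Finset.mul_sum]
  refine Finset.sum_congr rfl fun y _ => ?_
  simp only [productLaw, stateLaw, Finset.prod_mul_distrib]
  ring

lemma logb_block (hp : ∀ s, p s ∈ stdSimplex ℝ V) (hB : ∀ s v, B s v ∈ stdSimplex ℝ Y)
    {ω : Fin n → S × V × Y} (hω : productLaw (fun _ => stateLaw π p B) ω ≠ 0) :
    0 < productLaw (fun i => B (ω i).1 (ω i).2.1) (fun i => (ω i).2.2) ∧
    0 < productLaw (fun i => outLaw p B (ω i).1) (fun i => (ω i).2.2) ∧
    Real.logb 2 (productLaw (fun i => B (ω i).1 (ω i).2.1) (fun i => (ω i).2.2) /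
      productLaw (fun i => outLaw p B (ω i).1) (fun i => (ω i).2.2)) =
        ∑ i, infoDensity p B (ω i) := by
  have h0 : ∀ i, stateLaw π p B (ω i) ≠ 0 := fun i =>
    Finset.prod_ne_zero_iff.1 hω i (Finset.mem_univ i)
  have hB0 : ∀ i, 0 < B (ω i).1 (ω i).2.1 (ω i).2.2 := fun i =>
    ((hB _ _).1 _).lt_of_ne (right_ne_zero_of_mul (h0 i)).symm
  have hq0 : ∀ i, 0 < outLaw p B (ω i).1 (ω i).2.2 := fun i =>
    ((outLaw_mem hp hB _).1 _).lt_of_ne fun h =>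
      mul_ne_zero (right_ne_zero_of_mul (left_ne_zero_of_mul (h0 i))) (hB0 i).ne'
        (mul_eq_zero_of_outLaw_eq_zero hp hB h.symm _)
  refine ⟨Finset.prod_pos fun i _ => hB0 i, Finset.prod_pos fun i _ => hq0 i, ?_⟩
  simp only [productLaw]
  rw [← Finset.prod_div_distrib, Real.logb_prod]
  · rfl
  · exact fun i _ => (div_pos (hB0 i) (hq0 i)).ne'

/-- Second moment of the deviation of the information density of a block from its mean. -/
lemma sum_sq_infoDensity [Fintype S] (hπ : π ∈ stdSimplex ℝ S) (hp : ∀ s, p s ∈ stdSimplex ℝ V)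
    (hB : ∀ s v, B s v ∈ stdSimplex ℝ Y) :
    ∑ ω : Fin n → S × V × Y, productLaw (fun _ => stateLaw π p B) ω *
      (∑ i, infoDensity p B (ω i) - n * meanInfo π p B) ^ 2 = n * varInfo π p B := by
  have hJ := stateLaw_mem hπ hp hB
  have := sum_productLaw_sq (ι := Fin n) hJ.2
    (g := fun t => infoDensity p B t - meanInfo π p B) (by
      simp only [mul_sub, Finset.sum_sub_distrib, ← Finset.sum_mul, hJ.2]
      simp [meanInfo])
  simpa [varInfo] using this

/-- Chebyshev's inequality for the information density of a block. -/
lemma atypical_le [Fintype S] (hπ : π ∈ stdSimplex ℝ S) (hp : ∀ s, p s ∈ stdSimplex ℝ V)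
    (hB : ∀ s v, B s v ∈ stdSimplex ℝ Y) {δ : ℝ} (hδ : 0 < δ) (hn : 0 < n) :
    ∑ s, productLaw (fun _ => π) s * ∑ v, productLaw (fun i => p (s i)) v *
        ∑ y : Fin n → Y, productLaw (fun i => B (s i) (v i)) y *
          (if productLaw (fun i => B (s i) (v i)) y ≤
            2 ^ (n * (meanInfo π p B - δ)) * productLaw (fun i => outLaw p B (s i)) y
            then 1 else 0) ≤ varInfo π p B / (n * δ ^ 2) := by
  rw [sum_block π p B fun s v y => if productLaw (fun i => B (s i) (v i)) y ≤
    2 ^ (n * (meanInfo π p B - δ)) * productLaw (fun i => outLaw p B (s i)) y then 1 else 0]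
  have hn' : (0 : ℝ) < n := Nat.cast_pos.2 hn
  have hJ := productLaw_mem (ι := Fin n) fun _ => stateLaw_mem hπ hp hB
  have hbound : ∀ ω : Fin n → S × V × Y, productLaw (fun _ => stateLaw π p B) ω *
      (if productLaw (fun i => B (ω i).1 (ω i).2.1) (fun i => (ω i).2.2) ≤
        2 ^ (n * (meanInfo π p B - δ)) *
          productLaw (fun i => outLaw p B (ω i).1) (fun i => (ω i).2.2) then 1 else 0) ≤
      productLaw (fun _ => stateLaw π p B) ω *
        (∑ i, infoDensity p B (ω i) - n * meanInfo π p B) ^ 2 / (n * δ) ^ 2 := by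
    intro ω
    by_cases hω : productLaw (fun _ => stateLaw π p B) ω = 0
    · simp [hω]
    obtain ⟨hb, hq, hl⟩ := logb_block hp hB hω
    rw [mul_div_assoc]
    refine mul_le_mul_of_nonneg_left ?_ (hJ.1 ω)
    split_ifs with h
    · rw [one_le_div (by positivity)]
      have h1 : ∑ i, infoDensity p B (ω i) ≤ n * (meanInfo π p B - δ) := by
        rw [← hl, Real.logb_le_iff_le_rpow one_lt_two (div_pos hb hq), div_le_iff₀ hq]
        exact h
      have h2 : 0 < n * δ := by positivity
      nlinarith
    · positivity
  refine (Finset.sum_le_sum fun ω _ => hbound ω).trans_eq ?_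
  rw [← Finset.sum_div, sum_sq_infoDensity hπ hp hB]
  field_simp

lemma logb_one_add_le {r L : ℝ} (hr : 0 < r) (hL : 0 < L) :
    Real.logb 2 (1 + r / L) ≤ 1 + max 0 (Real.logb 2 r - Real.logb 2 L) := by
  have h : 1 + r / L ≤ 2 * max 1 (r / L) := by
    rcases le_total 1 (r / L) with h | h <;> simp [h] <;> linarith
  have hrL : 0 < r / L := div_pos hr hL
  refine (Real.logb_le_logb_of_le one_lt_two (by positivity) h).trans ?_
  rw [Real.logb_mul two_ne_zero (by positivity), Real.logb_self_eq_one one_lt_two,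
    ← Real.logb_div hr.ne' hL.ne']
  rcases le_total 1 (r / L) with h | h <;> simp [h]

/-- The mean of `log₂ (1 + 2 ^ i / L)`, where `i` is the information density of a block: up to a
deviation of order `√n` it is the excess of `n I(V;Y|S)` over `log₂ L`. -/
lemma sum_logb_one_add_le [Fintype S] (hπ : π ∈ stdSimplex ℝ S) (hp : ∀ s, p s ∈ stdSimplex ℝ V)
    (hB : ∀ s v, B s v ∈ stdSimplex ℝ Y) {δ L : ℝ} (hδ : 0 < δ) (hL : 0 < L) (hn : 0 < n) :
    ∑ s, productLaw (fun _ => π) s * ∑ v, productLaw (fun i => p (s i)) v *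
        ∑ y : Fin n → Y, productLaw (fun i => B (s i) (v i)) y *
          Real.logb 2 (1 + productLaw (fun i => B (s i) (v i)) y /
            productLaw (fun i => outLaw p B (s i)) y / L) ≤
      1 + max 0 (n * meanInfo π p B - Real.logb 2 L) + varInfo π p B / (2 * δ) + n * δ / 2 := by
  rw [sum_block π p B fun s v y => Real.logb 2 (1 + productLaw (fun i => B (s i) (v i)) y /
            productLaw (fun i => outLaw p B (s i)) y / L)]
  have hn' : (0 : ℝ) < n := Nat.cast_pos.2 hn
  have hJ := productLaw_mem (ι := Fin n) fun _ => stateLaw_mem hπ hp hB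
  set c : ℝ := 1 + max 0 (n * meanInfo π p B - Real.logb 2 L) + n * δ / 2
  have hbound : ∀ ω : Fin n → S × V × Y, productLaw (fun _ => stateLaw π p B) ω *
      Real.logb 2 (1 + productLaw (fun i => B (ω i).1 (ω i).2.1) (fun i => (ω i).2.2) /
          productLaw (fun i => outLaw p B (ω i).1) (fun i => (ω i).2.2) / L) ≤
      productLaw (fun _ => stateLaw π p B) ω * c +
      productLaw (fun _ => stateLaw π p B) ω *
        (∑ i, infoDensity p B (ω i) - n * meanInfo π p B) ^ 2 / (2 * (n * δ)) := by
    intro ω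
    by_cases hω : productLaw (fun _ => stateLaw π p B) ω = 0
    · simp [hω]
    obtain ⟨hb, hq, hl⟩ := logb_block hp hB hω
    rw [mul_div_assoc, ← mul_add]
    refine mul_le_mul_of_nonneg_left ?_ (hJ.1 ω)
    refine (logb_one_add_le (div_pos hb hq) hL).trans ?_
    rw [hl]
    set x := ∑ i, infoDensity p B (ω i)
    -- `x ≤ x² / (2t) + t / 2` with `t = n δ` turns the variance into a bound on the deviation
    have h1 : x - n * meanInfo π p B ≤
        (x - n * meanInfo π p B) ^ 2 / (2 * (n * δ)) + n * δ / 2 := by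
      have ht : 0 < n * δ := by positivity
      rw [div_add_div _ _ (by positivity) two_ne_zero, le_div_iff₀ (by positivity)]
      nlinarith [sq_nonneg (x - n * meanInfo π p B - n * δ)]
    have h2 : 0 ≤ (x - n * meanInfo π p B) ^ 2 / (2 * (n * δ)) := by positivity
    have h3 : 0 ≤ n * δ / 2 := by positivity
    have h4 : max 0 (x - Real.logb 2 L) ≤ max 0 (n * meanInfo π p B - Real.logb 2 L) +
        ((x - n * meanInfo π p B) ^ 2 / (2 * (n * δ)) + n * δ / 2) := by
      refine max_le (by positivity) ?_
      have := le_max_right 0 (n * meanInfo π p B - Real.logb 2 L)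
      linarith
    simp only [c]
    linarith
  refine (Finset.sum_le_sum fun ω _ => hbound ω).trans_eq ?_
  rw [Finset.sum_add_distrib, ← Finset.sum_mul, hJ.2, ← Finset.sum_div,
    sum_sq_infoDensity hπ hp hB]
  simp only [c]
  field_simp
  ring

end Block

/-! ### Random codebooks for a single use of a channel -/

/-- The output law when the codeword is drawn uniformly from `C`. -/
noncomputable def mixture {Λ α β : Type*} [Fintype Λ] (T : α → β → ℝ) (C : Λ → α) (y : β) : ℝ :=
  1 / (Fintype.card Λ : ℝ) * ∑ l, T (C l) y

lemma mixture_mem {Λ α β : Type*} [Fintype Λ] [Nonempty Λ] [Fintype β] {T : α → β → ℝ}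
    (hT : ∀ a, T a ∈ stdSimplex ℝ β) (C : Λ → α) : mixture T C ∈ stdSimplex ℝ β := by
  refine ⟨fun y => mul_nonneg (by positivity) (Finset.sum_nonneg fun l _ => (hT _).1 _), ?_⟩
  simp only [mixture]
  rw [← Finset.mul_sum, Finset.sum_comm]
  simp [(hT _).2]

section OneShot

variable {J α β : Type*} [Fintype J] [DecidableEq J] [Fintype α] [Fintype β]

open Classical in
/-- The decoder which picks an index `j` whose codeword has likelihood ratio `T (C j) y / q y`
above the threshold `θ`, if there is one. -/
noncomputable def thresholdDecoder {J α β : Type*} [Nonempty J] (T : α → β → ℝ) (q : β → ℝ) (θ : ℝ)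
    (C : J → α) (y : β) : J :=
  if h : ∃ j, θ * q y < T (C j) y then h.choose else Classical.arbitrary J

lemma thresholdDecoder_ne {J α β : Type*} [Nonempty J] {T : α → β → ℝ} {q : β → ℝ} {θ : ℝ}
    {C : J → α} {y : β} {j : J} (h : thresholdDecoder T q θ C y ≠ j) :
    T (C j) y ≤ θ * q y ∨ ∃ j', j ≠ j' ∧ θ * q y < T (C j') y := by
  by_contra! hcon
  have hex : ∃ j, θ * q y < T (C j) y := ⟨j, hcon.1⟩
  rw [thresholdDecoder, dif_pos hex] at h
  exact absurd hex.choose_spec (not_lt.2 (hcon.2 _ h.symm))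

/-- The mean error probability of the threshold decoder over a random codebook. A wrong codeword is
independent of the output, so it passes the threshold with probability at most `1 / θ`. -/
lemma sum_error_le [Nonempty J] {μ : α → ℝ} (hμ : μ ∈ stdSimplex ℝ α) {T : α → β → ℝ}
    (hT : ∀ a, T a ∈ stdSimplex ℝ β) {q : β → ℝ} (hq : ∀ y, ∑ a, μ a * T a y = q y) {θ : ℝ}
    (hθ : 0 < θ) (j : J) :
    ∑ C, productLaw (fun _ : J => μ) C *
        ∑ y, T (C j) y * (if thresholdDecoder T q θ C y ≠ j then 1 else 0) ≤
      ∑ a, μ a * ∑ y, T a y * (if T a y ≤ θ * q y then 1 else 0) +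
        (Fintype.card J - 1) / θ := by
  have hP := productLaw_mem (ι := J) fun _ => hμ
  have hpt : ∀ (C : J → α) (y : β),
      T (C j) y * (if thresholdDecoder T q θ C y ≠ j then 1 else 0) ≤
      T (C j) y * (if T (C j) y ≤ θ * q y then 1 else 0) +
        ∑ j' ∈ Finset.univ.erase j, T (C j) y * (if θ * q y < T (C j') y then 1 else 0) := by
    intro C y
    rw [← Finset.mul_sum, ← mul_add]
    refine mul_le_mul_of_nonneg_left ?_ ((hT _).1 _)
    have hs : ∀ j' ∈ Finset.univ.erase j,
        (0 : ℝ) ≤ if θ * q y < T (C j') y then 1 else 0 := fun j' _ => by positivity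
    have hs' := Finset.sum_nonneg hs
    split_ifs with h1 h2 h2
    · linarith
    · rcases thresholdDecoder_ne h1 with h | ⟨j', hj', h⟩
      · exact absurd h h2
      · have := Finset.single_le_sum hs (Finset.mem_erase.2 ⟨hj'.symm, Finset.mem_univ j'⟩)
        rw [if_pos h] at this
        linarith
    · linarith
    · linarith
  have hwrong : ∀ j' ∈ Finset.univ.erase j, ∑ C, productLaw (fun _ : J => μ) C *
      ∑ y, T (C j) y * (if θ * q y < T (C j') y then 1 else 0) ≤ 1 / θ := by
    intro j' hj'
    rw [sum_productLaw_pair (p := fun _ : J => μ) (fun _ => hμ.2) (Finset.ne_of_mem_erase hj').symm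
      fun a b => ∑ y, T a y * (if θ * q y < T b y then 1 else 0)]
    have h1 : ∑ a, μ a * ∑ b, μ b * ∑ y, T a y * (if θ * q y < T b y then 1 else 0) =
        ∑ b, μ b * ∑ y, q y * (if θ * q y < T b y then 1 else 0) := by
      simp only [← hq, Finset.sum_mul, Finset.mul_sum]
      rw [Finset.sum_comm]
      refine Finset.sum_congr rfl fun b _ => ?_
      rw [Finset.sum_comm]
      exact Finset.sum_congr rfl fun y _ => Finset.sum_congr rfl fun a _ => by ring
    rw [h1]
    have h2 : ∀ b, μ b * ∑ y, q y * (if θ * q y < T b y then 1 else 0) ≤ μ b * (1 / θ) := by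
      intro b
      refine mul_le_mul_of_nonneg_left ?_ (hμ.1 b)
      calc ∑ y, q y * (if θ * q y < T b y then 1 else 0) ≤ ∑ y, T b y / θ := by
            refine Finset.sum_le_sum fun y _ => ?_
            split_ifs with h
            · rw [mul_one, le_div_iff₀ hθ, mul_comm]
              exact h.le
            · have := (hT b).1 y
              rw [mul_zero]
              positivity
        _ = 1 / θ := by rw [← Finset.sum_div, (hT b).2]
    refine (Finset.sum_le_sum fun b _ => h2 b).trans_eq ?_
    rw [← Finset.sum_mul, hμ.2, one_mul]
  calc _ ≤ ∑ C, productLaw (fun _ : J => μ) C * ∑ y,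
        (T (C j) y * (if T (C j) y ≤ θ * q y then 1 else 0) +
        ∑ j' ∈ Finset.univ.erase j, T (C j) y * (if θ * q y < T (C j') y then 1 else 0)) :=
        Finset.sum_le_sum fun C _ => mul_le_mul_of_nonneg_left
          (Finset.sum_le_sum fun y _ => hpt C y) (hP.1 C)
    _ = ∑ C, productLaw (fun _ : J => μ) C *
          (∑ y, T (C j) y * (if T (C j) y ≤ θ * q y then 1 else 0)) +
        ∑ j' ∈ Finset.univ.erase j, ∑ C, productLaw (fun _ : J => μ) C *
          ∑ y, T (C j) y * (if θ * q y < T (C j') y then 1 else 0) := by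
        rw [Finset.sum_comm (s := Finset.univ.erase j), ← Finset.sum_add_distrib]
        refine Finset.sum_congr rfl fun C _ => ?_
        rw [Finset.sum_add_distrib, mul_add, Finset.sum_comm (t := Finset.univ.erase j),
          Finset.mul_sum (s := Finset.univ.erase j)]
    _ ≤ _ := by
        refine add_le_add (le_of_eq ?_) ((Finset.sum_le_sum hwrong).trans_eq ?_)
        · exact sum_productLaw_single (p := fun _ : J => μ) (fun _ => hμ.2) j
            fun a => ∑ y, T a y * (if T a y ≤ θ * q y then 1 else 0)
        · rw [Finset.sum_const, Finset.card_erase_of_mem (Finset.mem_univ j), Finset.card_univ,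
            nsmul_eq_mul, Nat.cast_sub Fintype.card_pos, Nat.cast_one]
          ring

/-- The divergence, in bits, of the mixture of the outputs of the codewords from `q`. -/
noncomputable def mixtureDivergence {Λ α β : Type*} [Fintype Λ] [Fintype β] (T : α → β → ℝ)
    (q : β → ℝ) (C : Λ → α) : ℝ :=
  ∑ y, mixture T C y * Real.logb 2 (mixture T C y / q y)

lemma logb_le_tangent {x z : ℝ} (hx : 0 < x) (hz : 0 < z) :
    Real.logb 2 x ≤ Real.logb 2 z + (x - z) / (z * Real.log 2) := by
  have hl2 : 0 < Real.log 2 := Real.log_pos one_lt_two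
  have h := Real.log_le_sub_one_of_pos (div_pos hx hz)
  rw [Real.log_div hx.ne' hz.ne'] at h
  have h2 : (x - z) / (z * Real.log 2) = (x / z - 1) / Real.log 2 := by field_simp
  rw [h2, Real.logb, Real.logb, ← add_div]
  exact div_le_div_of_nonneg_right (by linarith) hl2.le

/-- Soft covering: the mean divergence, over a random codebook, between the output of a uniformly
drawn codeword and the output of the random coding law. Given the codeword in use, the other
codewords contribute a mean of at most one to the likelihood ratio, and the logarithm lies below its
tangent. -/
lemma sum_mixtureDivergence_le {Λ : Type*} [Fintype Λ] [Nonempty Λ] {e : Λ → J}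
    (he : Function.Injective e) {μ : α → ℝ} (hμ : μ ∈ stdSimplex ℝ α) {T : α → β → ℝ}
    (hT : ∀ a, T a ∈ stdSimplex ℝ β) {q : β → ℝ} (hq : ∀ y, ∑ a, μ a * T a y = q y) :
    ∑ C, productLaw (fun _ : J => μ) C * mixtureDivergence T q (fun l => C (e l)) ≤
      ∑ a, μ a * ∑ y, T a y * Real.logb 2 (1 + T a y / q y / Fintype.card Λ) := by
  classical
  have hP := productLaw_mem (ι := J) fun _ => hμ
  have hl2 : 0 < Real.log 2 := Real.log_pos one_lt_two
  set L : ℝ := (Fintype.card Λ : ℝ) with hLdef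
  have hL : 0 < L := Nat.cast_pos.2 Fintype.card_pos
  have hq0 : ∀ y, 0 ≤ q y := fun y => by
    rw [← hq]
    exact Finset.sum_nonneg fun a _ => mul_nonneg (hμ.1 a) ((hT a).1 y)
  -- slope of the logarithm at the contribution of the codeword `a` in use
  set G : α → β → ℝ := fun a y => T a y / (L * ((1 + T a y / q y / L) * Real.log 2)) with hG
  have hG0 : ∀ a y, 0 ≤ G a y := fun a y => by
    have h1 := (hT a).1 y
    have h2 := hq0 y
    simp only [hG]
    positivity
  have hpt : ∀ (C : J → α) (l : Λ) (y : β), productLaw (fun _ : J => μ) C * (T (C (e l)) y *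
      Real.logb 2 (mixture T (fun l => C (e l)) y / q y)) ≤
      productLaw (fun _ : J => μ) C * (T (C (e l)) y *
        Real.logb 2 (1 + T (C (e l)) y / q y / L)) +
      ∑ l' ∈ Finset.univ.erase l, productLaw (fun _ : J => μ) C *
        (G (C (e l)) y * (T (C (e l')) y / q y - 1)) := by
    intro C l y
    rw [← Finset.mul_sum, ← mul_add]
    by_cases hC : productLaw (fun _ : J => μ) C = 0
    · simp [hC]
    refine mul_le_mul_of_nonneg_left ?_ (hP.1 C)
    rcases ((hT (C (e l))).1 y).eq_or_lt with h0 | hT0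
    · simp [← h0, hG]
    have hμ0 : 0 < μ (C (e l)) := (hμ.1 _).lt_of_ne fun h =>
      Finset.prod_ne_zero_iff.1 hC (e l) (Finset.mem_univ _) h.symm
    have hqy : 0 < q y := by
      rw [← hq]
      exact (mul_pos hμ0 hT0).trans_le (Finset.single_le_sum
        (f := fun a => μ a * T a y) (fun a _ => mul_nonneg (hμ.1 a) ((hT a).1 y))
        (Finset.mem_univ _))
    have hx : mixture T (fun l => C (e l)) y / q y = T (C (e l)) y / q y / L +
        ∑ l' ∈ Finset.univ.erase l, T (C (e l')) y / q y / L := by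
      rw [mixture, ← Finset.add_sum_erase _ _ (Finset.mem_univ l), ← Finset.sum_div,
        ← Finset.sum_div, ← hLdef]
      field_simp
    have hs : 0 ≤ ∑ l' ∈ Finset.univ.erase l, T (C (e l')) y / q y / L :=
      Finset.sum_nonneg fun l' _ => by
        have := (hT (C (e l'))).1 y
        positivity
    have hz : 0 < 1 + T (C (e l)) y / q y / L := by positivity
    have hcard : ∑ l' ∈ Finset.univ.erase l, (1 : ℝ) / L ≤ 1 := by
      rw [Finset.sum_const, Finset.card_erase_of_mem (Finset.mem_univ l), Finset.card_univ,
        nsmul_eq_mul, Nat.cast_sub Fintype.card_pos, Nat.cast_one, mul_one_div, div_le_one hL]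
      simp [hLdef]
    have hlog := logb_le_tangent (x := mixture T (fun l => C (e l)) y / q y)
      (by rw [hx]; positivity) hz
    have hdiff : mixture T (fun l => C (e l)) y / q y - (1 + T (C (e l)) y / q y / L) ≤
        ∑ l' ∈ Finset.univ.erase l, (T (C (e l')) y / q y - 1) / L := by
      simp only [sub_div, Finset.sum_sub_distrib]
      rw [hx]
      linarith
    calc T (C (e l)) y * Real.logb 2 (mixture T (fun l => C (e l)) y / q y)
        ≤ T (C (e l)) y * (Real.logb 2 (1 + T (C (e l)) y / q y / L) +
          (∑ l' ∈ Finset.univ.erase l, (T (C (e l')) y / q y - 1) / L) /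
            ((1 + T (C (e l)) y / q y / L) * Real.log 2)) := by
          refine mul_le_mul_of_nonneg_left (hlog.trans ?_) hT0.le
          gcongr
      _ = _ := by
          rw [mul_add, ← Finset.mul_sum, ← Finset.sum_div]
          simp only [hG]
          congr 1
          field_simp
  have hcross : ∀ (l : Λ) (y : β), ∀ l' ∈ Finset.univ.erase l,
      ∑ C, productLaw (fun _ : J => μ) C * (G (C (e l)) y * (T (C (e l')) y / q y - 1)) ≤ 0 := by
    intro l y l' hl'
    rw [sum_productLaw_pair (p := fun _ : J => μ) (fun _ => hμ.2)
      (he.ne (Finset.ne_of_mem_erase hl').symm) fun a b => G a y * (T b y / q y - 1)]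
    refine Finset.sum_nonpos fun a _ => mul_nonpos_of_nonneg_of_nonpos (hμ.1 a) ?_
    have h1 : ∑ b, μ b * (G a y * (T b y / q y - 1)) = G a y * (q y / q y - 1) := by
      have : ∀ b, μ b * (G a y * (T b y / q y - 1)) =
          G a y * (μ b * T b y / q y - μ b) := fun b => by ring
      rw [Finset.sum_congr rfl fun b _ => this b, ← Finset.mul_sum, Finset.sum_sub_distrib,
        ← Finset.sum_div, hq, hμ.2]
    rw [h1]
    exact mul_nonpos_of_nonneg_of_nonpos (hG0 a y) (by linarith [div_self_le_one (q y)])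
  have hly : ∀ (l : Λ) (y : β), ∑ C, productLaw (fun _ : J => μ) C * (T (C (e l)) y *
      Real.logb 2 (mixture T (fun l => C (e l)) y / q y)) ≤
      ∑ a, μ a * (T a y * Real.logb 2 (1 + T a y / q y / L)) := by
    intro l y
    refine (Finset.sum_le_sum fun C _ => hpt C l y).trans ?_
    rw [Finset.sum_add_distrib, Finset.sum_comm (t := Finset.univ.erase l),
      sum_productLaw_single (p := fun _ : J => μ) (fun _ => hμ.2) (e l)
        fun a => T a y * Real.logb 2 (1 + T a y / q y / L)]
    linarith [Finset.sum_nonpos (hcross l y)]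
  have hexp : ∀ C : J → α, productLaw (fun _ : J => μ) C *
      mixtureDivergence T q (fun l => C (e l)) = ∑ l, ∑ y, 1 / L *
        (productLaw (fun _ : J => μ) C * (T (C (e l)) y *
          Real.logb 2 (mixture T (fun l => C (e l)) y / q y))) := by
    intro C
    rw [mixtureDivergence, Finset.sum_comm, Finset.mul_sum]
    refine Finset.sum_congr rfl fun y _ => ?_
    generalize Real.logb 2 (mixture T (fun l => C (e l)) y / q y) = r
    rw [mixture, ← hLdef, ← mul_assoc, ← mul_assoc, Finset.mul_sum, Finset.sum_mul]
    refine Finset.sum_congr rfl fun l _ => ?_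
    ring
  rw [Finset.sum_congr rfl fun C _ => hexp C, Finset.sum_comm]
  calc _ ≤ ∑ _l : Λ, ∑ y, 1 / L * ∑ a, μ a * (T a y * Real.logb 2 (1 + T a y / q y / L)) := by
        refine Finset.sum_le_sum fun l _ => ?_
        rw [Finset.sum_comm]
        refine Finset.sum_le_sum fun y _ => ?_
        rw [← Finset.mul_sum]
        exact mul_le_mul_of_nonneg_left (hly l y) (by positivity)
    _ = _ := by
        rw [Finset.sum_const, Finset.card_univ, nsmul_eq_mul, ← hLdef, ← Finset.mul_sum,
          ← mul_assoc, mul_one_div_cancel hL.ne', one_mul, Finset.sum_comm]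
        exact Finset.sum_congr rfl fun a _ => (Finset.mul_sum _ _ _).symm

end OneShot

/-! ### Information leakage -/

section Leakage

variable {Ω K β : Type*} [Fintype Ω] [Fintype K] [Fintype β] {M : ℕ}

lemma condEntropy_le_logb [NeZero M] {p : Ω → ℝ} (hp : p ∈ stdSimplex ℝ Ω) (X : Ω → Fin M)
    (Y : Ω → β) : condEntropy p X Y ≤ Real.logb 2 M := by
  have hM : (M : ℝ) ≠ 0 := Nat.cast_ne_zero.2 (NeZero.ne M)
  set a : Fin M × β → ℝ := law p fun ω => (X ω, Y ω) with ha
  have ha0 : ∀ t, 0 ≤ a t := law_nonneg hp.1 _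
  have hY0 : ∀ y, 0 ≤ law p Y y := law_nonneg hp.1 _
  have hac : ∀ t, law p Y t.2 = 0 → a t = 0 := by
    rintro ⟨x, y⟩ h
    rw [← sum_law_fst p X Y] at h
    exact (Finset.sum_eq_zero_iff_of_nonneg fun x _ => ha0 (x, y)).1 h x (Finset.mem_univ x)
  have h := gibbs_inequality (a := a) (b := fun t => law p Y t.2 / M) ha0
    (fun t => div_nonneg (hY0 _) (Nat.cast_nonneg M))
    (fun t ht => hac t ((div_eq_zero_iff.1 ht).resolve_right hM)) (by
      rw [ha, sum_law, Fintype.sum_prod_type]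
      simp only [Finset.sum_const, Finset.card_univ, Fintype.card_fin, nsmul_eq_mul,
        ← Finset.sum_div]
      rw [mul_div_cancel₀ _ hM, sum_law])
  have h2 : ∀ t, a t * Real.logb 2 (a t / (law p Y t.2 / M)) =
      a t * Real.logb 2 M + a t * Real.logb 2 (a t / law p Y t.2) := by
    intro t
    by_cases hat : a t = 0
    · simp [hat]
    have hYt : law p Y t.2 ≠ 0 := fun h0 => hat (hac t h0)
    rw [← mul_add, ← Real.logb_mul hM (div_ne_zero hat hYt)]
    congr 2
    field_simp
  rw [Finset.sum_congr rfl fun t _ => h2 t, Finset.sum_add_distrib, ← Finset.sum_mul, ha, sum_law,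
    hp.2, one_mul] at h
  rw [condEntropy, ← Fintype.sum_prod_type (f := fun t : Fin M × β =>
    law p (fun ω => (X ω, Y ω)) t * Real.logb 2 (law p (fun ω => (X ω, Y ω)) t / law p Y t.2))]
  linarith

/-- An upper bound for the leakage `log₂ M - H(X|Y)` about a uniform message `X`, when
`P(y|x) = 1 / |K| ∑ Q x k y` for a uniform auxiliary variable `k`: it does not exceed the mean
divergence of `Q x k` from any law `q k` which depends on `k` only. This combines the data processing
inequality, by which `k` may be revealed, with the variational bound on mutual information. -/
lemma logb_sub_condEntropy_le [NeZero M] [Nonempty K] {p : Ω → ℝ} {X : Ω → Fin M} {Y : Ω → β}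
    {Q : Fin M → K → β → ℝ} (hQ : ∀ w k, Q w k ∈ stdSimplex ℝ β) {q : K → β → ℝ}
    (hq : ∀ k, q k ∈ stdSimplex ℝ β) (hac : ∀ w k y, q k y = 0 → Q w k y = 0)
    (h : ∀ w y, law p (fun ω => (X ω, Y ω)) (w, y) =
      1 / ((M : ℝ) * Fintype.card K) * ∑ k, Q w k y) :
    Real.logb 2 M - condEntropy p X Y ≤
      1 / (M : ℝ) * ∑ w, 1 / (Fintype.card K : ℝ) * ∑ k, ∑ y,
        Q w k y * Real.logb 2 (Q w k y / q k y) := by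
  have hM : (0 : ℝ) < M := Nat.cast_pos.2 (NeZero.pos M)
  have hK : (0 : ℝ) < Fintype.card K := Nat.cast_pos.2 Fintype.card_pos
  set c : ℝ := 1 / ((M : ℝ) * Fintype.card K) with hc
  have hc0 : 0 < c := by positivity
  set R : Fin M → β → ℝ := fun w y => ∑ k, Q w k y with hR
  set R' : β → ℝ := fun y => ∑ w, R w y with hR'
  have hR0 : ∀ w y, 0 ≤ R w y := fun w y => Finset.sum_nonneg fun k _ => (hQ w k).1 y
  have hR'0 : ∀ y, 0 ≤ R' y := fun y => Finset.sum_nonneg fun w _ => hR0 w y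
  have hQR : ∀ w k y, R w y = 0 → Q w k y = 0 := fun w k y h0 =>
    (Finset.sum_eq_zero_iff_of_nonneg fun k _ => (hQ w k).1 y).1 h0 k (Finset.mem_univ k)
  have hRR' : ∀ w y, R' y = 0 → R w y = 0 := fun w y h0 =>
    (Finset.sum_eq_zero_iff_of_nonneg fun w _ => hR0 w y).1 h0 w (Finset.mem_univ w)
  have hY : ∀ y, law p Y y = c * R' y := by
    intro y
    rw [← sum_law_fst p X Y]
    simp only [h, hR', ← Finset.mul_sum]
    rfl
  have hmass : ∑ t : Fin M × K × β, c * Q t.1 t.2.1 t.2.2 = 1 := by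
    simp only [Fintype.sum_prod_type, ← Finset.mul_sum, (hQ _ _).2, Finset.sum_const,
      Finset.card_univ, Fintype.card_fin, nsmul_eq_mul, mul_one]
    rw [hc]
    field_simp
  have hb : ∑ t : Fin M × K × β, c * (q t.2.1 t.2.2 * (M * R t.1 t.2.2 / R' t.2.2)) ≤ 1 := by
    have h1 : ∀ k y, ∑ w, c * (q k y * (M * R w y / R' y)) ≤ c * M * q k y := by
      intro k y
      have : ∑ w, c * (q k y * (M * R w y / R' y)) = c * M * q k y * (R' y / R' y) := by
        rw [hR', ← Finset.mul_sum, ← Finset.mul_sum, ← Finset.sum_div, ← Finset.mul_sum]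
        ring
      rw [this]
      have h0 := (hq k).1 y
      exact mul_le_of_le_one_right (by positivity) (div_self_le_one _)
    rw [Fintype.sum_prod_type, Finset.sum_comm]
    refine (Finset.sum_le_sum fun t _ => h1 t.1 t.2).trans_eq ?_
    simp only [Fintype.sum_prod_type, ← Finset.mul_sum, (hq _).2, Finset.sum_const,
      Finset.card_univ, nsmul_eq_mul, mul_one]
    rw [hc]
    field_simp
  have hgibbs := gibbs_inequality (a := fun t : Fin M × K × β => c * Q t.1 t.2.1 t.2.2)
    (b := fun t => c * (q t.2.1 t.2.2 * (M * R t.1 t.2.2 / R' t.2.2)))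
    (fun t => mul_nonneg hc0.le ((hQ _ _).1 _))
    (fun t => by
      have h0 := (hq t.2.1).1 t.2.2
      have h1 := hR0 t.1 t.2.2
      have h2 := hR'0 t.2.2
      positivity)
    (fun t ht => by
      have h1 : Q t.1 t.2.1 t.2.2 = 0 := by
        rcases mul_eq_zero.1 ((mul_eq_zero.1 ht).resolve_left hc0.ne') with h0 | h0
        · exact hac _ _ _ h0
        · rcases div_eq_zero_iff.1 h0 with h0 | h0
          · exact hQR _ _ _ ((mul_eq_zero.1 h0).resolve_left hM.ne')
          · exact hQR _ _ _ (hRR' _ _ h0)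
      rw [h1, mul_zero]) (hb.trans_eq hmass.symm)
  have hsplit : ∀ t : Fin M × K × β, c * Q t.1 t.2.1 t.2.2 * Real.logb 2
      (c * Q t.1 t.2.1 t.2.2 / (c * (q t.2.1 t.2.2 * (M * R t.1 t.2.2 / R' t.2.2)))) =
      c * (Q t.1 t.2.1 t.2.2 * Real.logb 2 (Q t.1 t.2.1 t.2.2 / q t.2.1 t.2.2)) -
      c * Q t.1 t.2.1 t.2.2 * Real.logb 2 M -
      c * (Q t.1 t.2.1 t.2.2 * Real.logb 2 (R t.1 t.2.2 / R' t.2.2)) := by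
    rintro ⟨w, k, y⟩
    simp only
    by_cases h0 : Q w k y = 0
    · simp [h0]
    have hq1 : q k y ≠ 0 := fun h1 => h0 (hac w k y h1)
    have hR1 : R w y ≠ 0 := fun h1 => h0 (hQR w k y h1)
    have hR2 : R' y ≠ 0 := fun h1 => hR1 (hRR' w y h1)
    have e : c * Q w k y / (c * (q k y * (M * R w y / R' y))) =
        Q w k y / q k y / M / (R w y / R' y) := by
      field_simp
    rw [e, Real.logb_div (by positivity) (by positivity), Real.logb_div (by positivity) hM.ne']
    ring
  rw [Finset.sum_congr rfl fun t _ => hsplit t, Finset.sum_sub_distrib, Finset.sum_sub_distrib,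
    ← Finset.sum_mul, hmass, one_mul] at hgibbs
  have hent : condEntropy p X Y =
      -∑ t : Fin M × K × β, c * (Q t.1 t.2.1 t.2.2 * Real.logb 2 (R t.1 t.2.2 / R' t.2.2)) := by
    rw [condEntropy, neg_inj, Fintype.sum_prod_type]
    refine Finset.sum_congr rfl fun w _ => ?_
    rw [Fintype.sum_prod_type, Finset.sum_comm]
    refine Finset.sum_congr rfl fun y _ => ?_
    simp only [h, hY]
    rw [mul_div_mul_left _ _ hc0.ne', ← Finset.mul_sum, ← Finset.sum_mul, mul_assoc]
  have hrhs : 1 / (M : ℝ) * ∑ w, 1 / (Fintype.card K : ℝ) * ∑ k, ∑ y,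
        Q w k y * Real.logb 2 (Q w k y / q k y) =
      ∑ t : Fin M × K × β, c * (Q t.1 t.2.1 t.2.2 *
        Real.logb 2 (Q t.1 t.2.1 t.2.2 / q t.2.1 t.2.2)) := by
    simp only [Fintype.sum_prod_type, ← Finset.mul_sum]
    rw [hc, ← mul_assoc, one_div_mul_one_div]
  rw [hrhs, hent]
  linarith

end Leakage

/-! ### The code of a pair of codebooks -/

lemma sum_comm_pairs {α β γ δ : Type*} [Fintype α] [Fintype β] [Fintype γ] [Fintype δ]
    (F : α → β → γ → δ → ℝ) :
    ∑ a, ∑ b, ∑ c, ∑ d, F a b c d = ∑ c, ∑ d, ∑ a, ∑ b, F a b c d := by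
  have h := Finset.sum_comm (s := (Finset.univ : Finset (α × β)))
    (t := (Finset.univ : Finset (γ × δ))) (f := fun x y => F x.1 x.2 y.1 y.2)
  simpa only [Fintype.sum_prod_type] using h

section Codebook

variable {X₁ X₂ Y₁ Y₂ V₁ V₂ : Type*} [Fintype X₁] [Fintype X₂] [Fintype Y₁] [Fintype Y₂]
  {n M₁ M₂ L₁ L₂ : ℕ}

lemma outputLaw_nonneg {W : X₁ → X₂ → Y₁ × Y₂ → ℝ} (hW : IsChannel W)
    (c : Code X₁ X₂ Y₁ Y₂ n M₁ M₂) (w₁ : Fin M₁) (w₂ : Fin M₂) (y₁ : Fin n → Y₁)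
    (y₂ : Fin n → Y₂) : 0 ≤ c.outputLaw W w₁ w₂ y₁ y₂ :=
  Finset.sum_nonneg fun x₁ _ => Finset.sum_nonneg fun x₂ _ =>
    mul_nonneg (mul_nonneg ((c.f₁_mem w₁).1 x₁) ((c.f₂_mem w₂).1 x₂))
      (Finset.prod_nonneg fun _ _ => (hW _ _).1 _)

lemma error₁_nonneg {W : X₁ → X₂ → Y₁ × Y₂ → ℝ} (hW : IsChannel W)
    (c : Code X₁ X₂ Y₁ Y₂ n M₁ M₂) : 0 ≤ c.error₁ W :=
  Finset.sum_nonneg fun w₁ _ => Finset.sum_nonneg fun w₂ _ => mul_nonneg (by positivity)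
    (Finset.sum_nonneg fun y₁ _ => Finset.sum_nonneg fun y₂ _ => by
      split_ifs
      exacts [outputLaw_nonneg hW c w₁ w₂ y₁ y₂, le_rfl])

lemma error₂_nonneg {W : X₁ → X₂ → Y₁ × Y₂ → ℝ} (hW : IsChannel W)
    (c : Code X₁ X₂ Y₁ Y₂ n M₁ M₂) : 0 ≤ c.error₂ W :=
  Finset.sum_nonneg fun w₁ _ => Finset.sum_nonneg fun w₂ _ => mul_nonneg (by positivity)
    (Finset.sum_nonneg fun y₁ _ => Finset.sum_nonneg fun y₂ _ => by
      split_ifs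
      exacts [outputLaw_nonneg hW c w₁ w₂ y₁ y₂, le_rfl])

/-- The channel from the auxiliary inputs `v₁, v₂` to both outputs. -/
noncomputable def auxChannel (q₁ : V₁ → X₁ → ℝ) (q₂ : V₂ → X₂ → ℝ) (W : X₁ → X₂ → Y₁ × Y₂ → ℝ)
    (v₁ : V₁) (v₂ : V₂) (y : Y₁ × Y₂) : ℝ :=
  ∑ x₁, ∑ x₂, q₁ v₁ x₁ * q₂ v₂ x₂ * W x₁ x₂ y

/-- The channel from the auxiliary inputs to the first output. -/
noncomputable def auxChannel₁ (q₁ : V₁ → X₁ → ℝ) (q₂ : V₂ → X₂ → ℝ) (W : X₁ → X₂ → Y₁ × Y₂ → ℝ)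
    (v₁ : V₁) (v₂ : V₂) (y₁ : Y₁) : ℝ :=
  ∑ y₂, auxChannel q₁ q₂ W v₁ v₂ (y₁, y₂)

/-- The channel from the auxiliary inputs to the second output. -/
noncomputable def auxChannel₂ (q₁ : V₁ → X₁ → ℝ) (q₂ : V₂ → X₂ → ℝ) (W : X₁ → X₂ → Y₁ × Y₂ → ℝ)
    (v₁ : V₁) (v₂ : V₂) (y₂ : Y₂) : ℝ :=
  ∑ y₁, auxChannel q₁ q₂ W v₁ v₂ (y₁, y₂)

variable {q₁ : V₁ → X₁ → ℝ} {q₂ : V₂ → X₂ → ℝ} {W : X₁ → X₂ → Y₁ × Y₂ → ℝ}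

lemma auxChannel_mem (hq₁ : ∀ v, q₁ v ∈ stdSimplex ℝ X₁) (hq₂ : ∀ v, q₂ v ∈ stdSimplex ℝ X₂)
    (hW : IsChannel W) (v₁ : V₁) (v₂ : V₂) :
    auxChannel q₁ q₂ W v₁ v₂ ∈ stdSimplex ℝ (Y₁ × Y₂) := by
  refine ⟨fun y => Finset.sum_nonneg fun x₁ _ => Finset.sum_nonneg fun x₂ _ =>
    mul_nonneg (mul_nonneg ((hq₁ v₁).1 x₁) ((hq₂ v₂).1 x₂)) ((hW x₁ x₂).1 y), ?_⟩
  simp only [auxChannel]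
  rw [Finset.sum_comm]
  have : ∀ x₁, ∑ y, ∑ x₂, q₁ v₁ x₁ * q₂ v₂ x₂ * W x₁ x₂ y = q₁ v₁ x₁ := by
    intro x₁
    rw [Finset.sum_comm]
    simp [← Finset.mul_sum, (hW _ _).2, (hq₂ _).2]
  simp [this, (hq₁ v₁).2]

lemma auxChannel₁_mem (hq₁ : ∀ v, q₁ v ∈ stdSimplex ℝ X₁) (hq₂ : ∀ v, q₂ v ∈ stdSimplex ℝ X₂)
    (hW : IsChannel W) (v₁ : V₁) (v₂ : V₂) :
    auxChannel₁ q₁ q₂ W v₁ v₂ ∈ stdSimplex ℝ Y₁ := by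
  have h := auxChannel_mem hq₁ hq₂ hW v₁ v₂
  refine ⟨fun y₁ => Finset.sum_nonneg fun y₂ _ => h.1 _, ?_⟩
  rw [← h.2, Fintype.sum_prod_type]
  rfl

lemma auxChannel₂_mem (hq₁ : ∀ v, q₁ v ∈ stdSimplex ℝ X₁) (hq₂ : ∀ v, q₂ v ∈ stdSimplex ℝ X₂)
    (hW : IsChannel W) (v₁ : V₁) (v₂ : V₂) :
    auxChannel₂ q₁ q₂ W v₁ v₂ ∈ stdSimplex ℝ Y₂ := by
  have h := auxChannel_mem hq₁ hq₂ hW v₁ v₂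
  refine ⟨fun y₂ => Finset.sum_nonneg fun y₁ _ => h.1 _, ?_⟩
  rw [← h.2, Fintype.sum_prod_type, Finset.sum_comm]
  rfl

/-- The memoryless extension of a channel `A` with two inputs. -/
noncomputable def blockChannel {V V' Y : Type*} (A : V → V' → Y → ℝ) (v' : Fin n → V')
    (v : Fin n → V) (y : Fin n → Y) : ℝ :=
  productLaw (fun i => A (v i) (v' i)) y

/-- The probability that the decoder `d` errs about the index `j` of a uniformly drawn codeword of
`C`, when the other input of `A` is a uniformly drawn codeword of `C'`. -/
noncomputable def codebookError {V V' J J' Y : Type*} [Fintype J] [DecidableEq J] [Fintype J'] [Fintype Y]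
    (A : V → V' → Y → ℝ) (d : (Fin n → Y) → J) (C : J → Fin n → V) (C' : J' → Fin n → V') : ℝ :=
  1 / (Fintype.card J : ℝ) * ∑ j, 1 / (Fintype.card J' : ℝ) * ∑ k, ∑ y,
    blockChannel A (C' k) (C j) y * (if d y ≠ j then 1 else 0)

/-- The stochastic encoder which draws a codeword reserved for the message uniformly and passes it
through the memoryless extension of the prefix channel `q`. -/
noncomputable def prefixEncoder {V X : Type*} {M L : ℕ} (q : V → X → ℝ)
    (C : Fin M × Fin L → Fin n → V) (w : Fin M) : (Fin n → X) → ℝ :=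
  mixture (fun (v : Fin n → V) (x : Fin n → X) => productLaw (fun i => q (v i)) x) fun l => C (w, l)

lemma prefixEncoder_mem {V X : Type*} [Fintype X] {M L : ℕ} [NeZero L] {q : V → X → ℝ}
    (hq : ∀ v, q v ∈ stdSimplex ℝ X) (C : Fin M × Fin L → Fin n → V) (w : Fin M) :
    prefixEncoder q C w ∈ stdSimplex ℝ (Fin n → X) :=
  mixture_mem (T := fun (v : Fin n → V) (x : Fin n → X) => productLaw (fun i => q (v i)) x)
    (fun v => productLaw_mem fun i => hq (v i)) _

/-- The code of two codebooks. Each encoder `t` draws one of the `L_t` codewords reserved for its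
message and passes it through the prefix channel `q_t`. The decoders estimate the codeword and
return its message. -/
noncomputable def codebookCode [NeZero L₁] [NeZero L₂] (hq₁ : ∀ v, q₁ v ∈ stdSimplex ℝ X₁)
    (hq₂ : ∀ v, q₂ v ∈ stdSimplex ℝ X₂) (C₁ : Fin M₁ × Fin L₁ → Fin n → V₁)
    (C₂ : Fin M₂ × Fin L₂ → Fin n → V₂) (d₁ : (Fin n → Y₁) → Fin M₁ × Fin L₁)
    (d₂ : (Fin n → Y₂) → Fin M₂ × Fin L₂) : Code X₁ X₂ Y₁ Y₂ n M₁ M₂ where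
  f₁ := prefixEncoder q₁ C₁
  f₂ := prefixEncoder q₂ C₂
  f₁_mem := prefixEncoder_mem hq₁ C₁
  f₂_mem := prefixEncoder_mem hq₂ C₂
  ψ₁ y := (d₁ y).1
  ψ₂ y := (d₂ y).1

variable [NeZero L₁] [NeZero L₂] {hq₁ : ∀ v, q₁ v ∈ stdSimplex ℝ X₁}
  {hq₂ : ∀ v, q₂ v ∈ stdSimplex ℝ X₂} {C₁ : Fin M₁ × Fin L₁ → Fin n → V₁}
  {C₂ : Fin M₂ × Fin L₂ → Fin n → V₂} {d₁ : (Fin n → Y₁) → Fin M₁ × Fin L₁}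
  {d₂ : (Fin n → Y₂) → Fin M₂ × Fin L₂}

lemma outputLaw_codebookCode {Y₁ Y₂ : Type*} {W : X₁ → X₂ → Y₁ × Y₂ → ℝ}
    {d₁ : (Fin n → Y₁) → Fin M₁ × Fin L₁} {d₂ : (Fin n → Y₂) → Fin M₂ × Fin L₂}
    (w₁ : Fin M₁) (w₂ : Fin M₂) (y₁ : Fin n → Y₁) (y₂ : Fin n → Y₂) :
    (codebookCode hq₁ hq₂ C₁ C₂ d₁ d₂).outputLaw W w₁ w₂ y₁ y₂ =
      ∑ l₁, ∑ l₂, 1 / ((L₁ : ℝ) * L₂) *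
        productLaw (fun i => auxChannel q₁ q₂ W (C₁ (w₁, l₁) i) (C₂ (w₂, l₂) i))
          (fun i => (y₁ i, y₂ i)) := by
  have h : ∀ (v₁ : Fin n → V₁) (v₂ : Fin n → V₂),
      productLaw (fun i => auxChannel q₁ q₂ W (v₁ i) (v₂ i)) (fun i => (y₁ i, y₂ i)) =
      ∑ x₁ : Fin n → X₁, ∑ x₂ : Fin n → X₂, productLaw (fun i => q₁ (v₁ i)) x₁ *
        productLaw (fun i => q₂ (v₂ i)) x₂ * ∏ i, W (x₁ i) (x₂ i) (y₁ i, y₂ i) := by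
    intro v₁ v₂
    have h1 : ∀ x₁ : Fin n → X₁, ∑ x₂ : Fin n → X₂, productLaw (fun i => q₁ (v₁ i)) x₁ *
        productLaw (fun i => q₂ (v₂ i)) x₂ * ∏ i, W (x₁ i) (x₂ i) (y₁ i, y₂ i) =
        productLaw (fun i z₁ => ∑ z₂, q₁ (v₁ i) z₁ * q₂ (v₂ i) z₂ * W z₁ z₂ (y₁ i, y₂ i)) x₁ := by
      intro x₁
      have h2 := sum_productLaw (ι := Fin n) fun i z₂ =>
        q₁ (v₁ i) (x₁ i) * q₂ (v₂ i) z₂ * W (x₁ i) z₂ (y₁ i, y₂ i)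
      refine Eq.trans (Finset.sum_congr rfl fun x₂ _ => ?_) h2
      simp [productLaw, Finset.prod_mul_distrib]
    rw [Finset.sum_congr rfl fun x₁ _ => h1 x₁, sum_productLaw]
    rfl
  simp only [Code.outputLaw, h, Finset.mul_sum]
  rw [sum_comm_pairs]
  refine Finset.sum_congr rfl fun x₁ _ => Finset.sum_congr rfl fun x₂ _ => ?_
  simp only [codebookCode, prefixEncoder, mixture, Fintype.card_fin]
  rw [mul_mul_mul_comm, one_div_mul_one_div, Finset.sum_mul_sum, mul_assoc, Finset.sum_mul,
    Finset.mul_sum]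
  refine Finset.sum_congr rfl fun l₁ _ => ?_
  rw [Finset.sum_mul, Finset.mul_sum]

/-- The law of the first output: the codewords are uniform given the messages and pass through the
memoryless extension of the first auxiliary channel. -/
lemma sum_outputLaw₁ {Y₁ : Type*} {W : X₁ → X₂ → Y₁ × Y₂ → ℝ}
    {d₁ : (Fin n → Y₁) → Fin M₁ × Fin L₁} (w₁ : Fin M₁) (w₂ : Fin M₂) (y₁ : Fin n → Y₁) :
    ∑ y₂, (codebookCode hq₁ hq₂ C₁ C₂ d₁ d₂).outputLaw W w₁ w₂ y₁ y₂ =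
      ∑ l₁, ∑ l₂, 1 / ((L₁ : ℝ) * L₂) *
        blockChannel (auxChannel₁ q₁ q₂ W) (C₂ (w₂, l₂)) (C₁ (w₁, l₁)) y₁ := by
  simp only [outputLaw_codebookCode]
  rw [Finset.sum_comm]
  refine Finset.sum_congr rfl fun l₁ _ => ?_
  rw [Finset.sum_comm]
  refine Finset.sum_congr rfl fun l₂ _ => ?_
  rw [← Finset.mul_sum]
  congr 1
  exact sum_productLaw (ι := Fin n) fun i z =>
    auxChannel q₁ q₂ W (C₁ (w₁, l₁) i) (C₂ (w₂, l₂) i) (y₁ i, z)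

lemma sum_outputLaw₂ {Y₂ : Type*} {W : X₁ → X₂ → Y₁ × Y₂ → ℝ}
    {d₂ : (Fin n → Y₂) → Fin M₂ × Fin L₂} (w₁ : Fin M₁) (w₂ : Fin M₂) (y₂ : Fin n → Y₂) :
    ∑ y₁, (codebookCode hq₁ hq₂ C₁ C₂ d₁ d₂).outputLaw W w₁ w₂ y₁ y₂ =
      ∑ l₁, ∑ l₂, 1 / ((L₁ : ℝ) * L₂) *
        blockChannel (auxChannel₂ q₁ q₂ W) (C₂ (w₂, l₂)) (C₁ (w₁, l₁)) y₂ := by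
  simp only [outputLaw_codebookCode]
  rw [Finset.sum_comm]
  refine Finset.sum_congr rfl fun l₁ _ => ?_
  rw [Finset.sum_comm]
  refine Finset.sum_congr rfl fun l₂ _ => ?_
  rw [← Finset.mul_sum]
  congr 1
  exact sum_productLaw (ι := Fin n) fun i z =>
    auxChannel q₁ q₂ W (C₁ (w₁, l₁) i) (C₂ (w₂, l₂) i) (z, y₂ i)

/-- A wrong message estimate requires a wrong codeword estimate. -/
lemma error₁_codebookCode_le (hW : IsChannel W) :
    (codebookCode hq₁ hq₂ C₁ C₂ d₁ d₂).error₁ W ≤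
      codebookError (auxChannel₁ q₁ q₂ W) d₁ C₁ C₂ := by
  have hA : ∀ v' v (y : Fin n → Y₁), 0 ≤ blockChannel (auxChannel₁ q₁ q₂ W) v' v y := fun v' v y =>
    productLaw_nonneg (fun i => (auxChannel₁_mem hq₁ hq₂ hW (v i) (v' i)).1) y
  have hy : ∀ w₁ w₂ y₁, ∑ y₂, (if (codebookCode hq₁ hq₂ C₁ C₂ d₁ d₂).ψ₁ y₁ ≠ w₁ then
        (codebookCode hq₁ hq₂ C₁ C₂ d₁ d₂).outputLaw W w₁ w₂ y₁ y₂ else 0) ≤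
      ∑ l₁, ∑ l₂, 1 / ((L₁ : ℝ) * L₂) *
        (blockChannel (auxChannel₁ q₁ q₂ W) (C₂ (w₂, l₂)) (C₁ (w₁, l₁)) y₁ *
          (if d₁ y₁ ≠ (w₁, l₁) then 1 else 0)) := by
    intro w₁ w₂ y₁
    by_cases h : (codebookCode hq₁ hq₂ C₁ C₂ d₁ d₂).ψ₁ y₁ ≠ w₁
    · simp only [if_pos h]
      rw [sum_outputLaw₁]
      refine Finset.sum_le_sum fun l₁ _ => Finset.sum_le_sum fun l₂ _ => ?_
      have h' : d₁ y₁ ≠ (w₁, l₁) := fun h0 => h (congrArg Prod.fst h0)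
      rw [if_pos h', mul_one]
    · simp only [if_neg h, Finset.sum_const_zero]
      refine Finset.sum_nonneg fun l₁ _ => Finset.sum_nonneg fun l₂ _ =>
        mul_nonneg (by positivity) (mul_nonneg (hA _ _ _) (by positivity))
  refine (Finset.sum_le_sum fun w₁ _ => Finset.sum_le_sum fun w₂ _ =>
    mul_le_mul_of_nonneg_left (Finset.sum_le_sum fun y₁ _ => hy w₁ w₂ y₁)
      (by positivity)).trans_eq ?_
  simp only [codebookError, Fintype.sum_prod_type, Finset.mul_sum, Fintype.card_prod,
    Fintype.card_fin, Nat.cast_mul]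
  refine Finset.sum_congr rfl fun w₁ _ => ?_
  rw [Finset.sum_comm (s := (Finset.univ : Finset (Fin L₁)))]
  refine Finset.sum_congr rfl fun w₂ _ => ?_
  rw [Finset.sum_comm]
  refine Finset.sum_congr rfl fun l₁ _ => ?_
  rw [Finset.sum_comm]
  refine Finset.sum_congr rfl fun l₂ _ => Finset.sum_congr rfl fun y _ => ?_
  simp only [one_div, mul_inv]
  ring

lemma error₂_codebookCode_le (hW : IsChannel W) :
    (codebookCode hq₁ hq₂ C₁ C₂ d₁ d₂).error₂ W ≤
      codebookError (fun v₂ v₁ => auxChannel₂ q₁ q₂ W v₁ v₂) d₂ C₂ C₁ := by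
  have hA : ∀ v' v (y : Fin n → Y₂),
      0 ≤ blockChannel (fun v₂ v₁ => auxChannel₂ q₁ q₂ W v₁ v₂) v' v y := fun v' v y =>
    productLaw_nonneg (fun i => (auxChannel₂_mem hq₁ hq₂ hW (v' i) (v i)).1) y
  have hy : ∀ w₁ w₂ y₂, ∑ y₁, (if (codebookCode hq₁ hq₂ C₁ C₂ d₁ d₂).ψ₂ y₂ ≠ w₂ then
        (codebookCode hq₁ hq₂ C₁ C₂ d₁ d₂).outputLaw W w₁ w₂ y₁ y₂ else 0) ≤
      ∑ l₁, ∑ l₂, 1 / ((L₁ : ℝ) * L₂) *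
        (blockChannel (fun v₂ v₁ => auxChannel₂ q₁ q₂ W v₁ v₂) (C₁ (w₁, l₁)) (C₂ (w₂, l₂)) y₂ *
          (if d₂ y₂ ≠ (w₂, l₂) then 1 else 0)) := by
    intro w₁ w₂ y₂
    by_cases h : (codebookCode hq₁ hq₂ C₁ C₂ d₁ d₂).ψ₂ y₂ ≠ w₂
    · simp only [if_pos h]
      rw [sum_outputLaw₂]
      refine Finset.sum_le_sum fun l₁ _ => Finset.sum_le_sum fun l₂ _ => ?_
      have h' : d₂ y₂ ≠ (w₂, l₂) := fun h0 => h (congrArg Prod.fst h0)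
      rw [if_pos h', mul_one]
      exact le_rfl
    · simp only [if_neg h, Finset.sum_const_zero]
      refine Finset.sum_nonneg fun l₁ _ => Finset.sum_nonneg fun l₂ _ =>
        mul_nonneg (by positivity) (mul_nonneg (hA _ _ _) (by positivity))
  rw [Code.error₂, Finset.sum_comm]
  refine (Finset.sum_le_sum fun w₂ _ => Finset.sum_le_sum fun w₁ _ =>
    mul_le_mul_of_nonneg_left (Finset.sum_comm.trans_le (Finset.sum_le_sum fun y₂ _ =>
      hy w₁ w₂ y₂)) (by positivity)).trans_eq ?_
  simp only [codebookError, Fintype.sum_prod_type, Finset.mul_sum, Fintype.card_prod,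
    Fintype.card_fin, Nat.cast_mul]
  refine Finset.sum_congr rfl fun w₂ _ => ?_
  rw [Finset.sum_comm (s := (Finset.univ : Finset (Fin L₂)))]
  refine Finset.sum_congr rfl fun w₁ _ => ?_
  rw [Finset.sum_comm, Finset.sum_comm (s := (Finset.univ : Finset (Fin L₂)))]
  refine Finset.sum_congr rfl fun l₁ _ => ?_
  rw [Finset.sum_comm]
  refine Finset.sum_congr rfl fun l₂ _ => Finset.sum_congr rfl fun y _ => ?_
  simp only [one_div, mul_inv]
  ring

/-- The joint law of the first message and the second output, with the index of the second user's
codeword as auxiliary variable. -/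
lemma law_jointLaw₁ (w : Fin M₁) (y : Fin n → Y₂) :
    law ((codebookCode hq₁ hq₂ C₁ C₂ d₁ d₂).jointLaw W) (fun ω => (ω.1, ω.2.2.2)) (w, y) =
      1 / ((M₁ : ℝ) * Fintype.card (Fin M₂ × Fin L₂)) *
        ∑ k, mixture (blockChannel (auxChannel₂ q₁ q₂ W) (C₂ k)) (fun l => C₁ (w, l)) y := by
  have h : law ((codebookCode hq₁ hq₂ C₁ C₂ d₁ d₂).jointLaw W) (fun ω => (ω.1, ω.2.2.2)) (w, y) =
      ∑ w₂, 1 / ((M₁ : ℝ) * M₂) *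
        ∑ y₁, (codebookCode hq₁ hq₂ C₁ C₂ d₁ d₂).outputLaw W w w₂ y₁ y := by
    simp only [law, Fintype.sum_prod_type, Prod.mk.injEq]
    rw [Finset.sum_eq_single w (fun w' _ hw' => by simp [hw']) (by simp)]
    refine Finset.sum_congr rfl fun w₂ _ => ?_
    rw [Finset.mul_sum]
    refine Finset.sum_congr rfl fun y₁ _ => ?_
    rw [Finset.sum_eq_single y (fun y' _ hy' => by simp [hy']) (by simp), if_pos rfl]
    rfl
  rw [h]
  simp only [sum_outputLaw₂, mixture, Fintype.sum_prod_type, Finset.mul_sum, Fintype.card_prod,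
    Fintype.card_fin, Nat.cast_mul]
  refine Finset.sum_congr rfl fun w₂ _ => ?_
  rw [Finset.sum_comm]
  refine Finset.sum_congr rfl fun l₂ _ => Finset.sum_congr rfl fun l₁ _ => ?_
  simp only [one_div, mul_inv]
  ring

lemma law_jointLaw₂ (w : Fin M₂) (y : Fin n → Y₁) :
    law ((codebookCode hq₁ hq₂ C₁ C₂ d₁ d₂).jointLaw W) (fun ω => (ω.2.1, ω.2.2.1)) (w, y) =
      1 / ((M₂ : ℝ) * Fintype.card (Fin M₁ × Fin L₁)) *
        ∑ k, mixture (blockChannel (fun v₂ v₁ => auxChannel₁ q₁ q₂ W v₁ v₂) (C₁ k))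
          (fun l => C₂ (w, l)) y := by
  have h : law ((codebookCode hq₁ hq₂ C₁ C₂ d₁ d₂).jointLaw W) (fun ω => (ω.2.1, ω.2.2.1)) (w, y) =
      ∑ w₁, 1 / ((M₁ : ℝ) * M₂) *
        ∑ y₂, (codebookCode hq₁ hq₂ C₁ C₂ d₁ d₂).outputLaw W w₁ w y y₂ := by
    simp only [law, Fintype.sum_prod_type, Prod.mk.injEq]
    refine Finset.sum_congr rfl fun w₁ _ => ?_
    rw [Finset.sum_eq_single w (fun w' _ hw' => by simp [hw']) (by simp),
      Finset.sum_eq_single y (fun y' _ hy' => by simp [hy']) (by simp)]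
    simp [Code.jointLaw, Finset.mul_sum]
  rw [h]
  simp only [sum_outputLaw₁, mixture, Fintype.sum_prod_type, Finset.mul_sum, Fintype.card_prod,
    Fintype.card_fin, Nat.cast_mul]
  refine Finset.sum_congr rfl fun w₁ _ => Finset.sum_congr rfl fun l₁ _ =>
    Finset.sum_congr rfl fun l₂ _ => ?_
  simp only [one_div, mul_inv, blockChannel]
  ring

lemma jointLaw_mem [NeZero M₁] [NeZero M₂] (hW : IsChannel W) :
    (codebookCode hq₁ hq₂ C₁ C₂ d₁ d₂).jointLaw W ∈
      stdSimplex ℝ (Fin M₁ × Fin M₂ × (Fin n → Y₁) × (Fin n → Y₂)) := by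
  have hM₁ : (M₁ : ℝ) ≠ 0 := Nat.cast_ne_zero.2 (NeZero.ne M₁)
  have hM₂ : (M₂ : ℝ) ≠ 0 := Nat.cast_ne_zero.2 (NeZero.ne M₂)
  have hL₁ : (L₁ : ℝ) ≠ 0 := Nat.cast_ne_zero.2 (NeZero.ne L₁)
  have hL₂ : (L₂ : ℝ) ≠ 0 := Nat.cast_ne_zero.2 (NeZero.ne L₂)
  refine ⟨fun ω => mul_nonneg (by positivity) (outputLaw_nonneg hW _ _ _ _ _), ?_⟩
  have hb : ∀ v' v, ∑ y : Fin n → Y₁, blockChannel (auxChannel₁ q₁ q₂ W) v' v y = 1 :=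
    fun v' v => (productLaw_mem fun i => auxChannel₁_mem hq₁ hq₂ hW (v i) (v' i)).2
  have h1 : ∀ w₁ w₂, ∑ y₁, ∑ y₂,
      (codebookCode hq₁ hq₂ C₁ C₂ d₁ d₂).outputLaw W w₁ w₂ y₁ y₂ = 1 := by
    intro w₁ w₂
    simp only [sum_outputLaw₁]
    rw [Finset.sum_comm]
    have : ∀ l₁, ∑ y₁, ∑ l₂, 1 / ((L₁ : ℝ) * L₂) *
        blockChannel (auxChannel₁ q₁ q₂ W) (C₂ (w₂, l₂)) (C₁ (w₁, l₁)) y₁ = 1 / L₁ := by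
      intro l₁
      rw [Finset.sum_comm]
      simp only [← Finset.mul_sum, hb]
      simp
      field_simp
    rw [Finset.sum_congr rfl fun l₁ _ => this l₁]
    simp [hL₁]
  simp only [Code.jointLaw, Fintype.sum_prod_type, ← Finset.mul_sum, h1]
  simp
  field_simp

end Codebook

/-! ### Means over random codebooks -/

section RandomCodebooks

variable {U V V' J J' Y : Type*} [Fintype U] [Fintype V] [Fintype V'] [Fintype J] [Fintype J']
  [DecidableEq J] [DecidableEq J'] [Fintype Y] {n M L : ℕ}

/-- The mean of `F` over a time-sharing sequence `u` with independent letters of law `pU` and two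
codebooks `C` and `C'`, whose codewords are independent given `u`, with independent letters of laws
`p (u i)` and `p' (u i)`. -/
noncomputable def codebookMean (pU : U → ℝ) (p : U → V → ℝ) (p' : U → V' → ℝ)
    (F : (Fin n → U) → (J → Fin n → V) → (J' → Fin n → V') → ℝ) : ℝ :=
  ∑ u, productLaw (fun _ => pU) u * ∑ C, productLaw (fun _ => productLaw fun i => p (u i)) C *
    ∑ C', productLaw (fun _ => productLaw fun i => p' (u i)) C' * F u C C'

variable {pU : U → ℝ} {p : U → V → ℝ} {p' : U → V' → ℝ}
  {F G : (Fin n → U) → (J → Fin n → V) → (J' → Fin n → V') → ℝ}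

lemma codebookMean_add : codebookMean pU p p' (fun u C C' => F u C C' + G u C C') =
    codebookMean pU p p' F + codebookMean pU p p' G := by
  simp only [codebookMean, mul_add, Finset.sum_add_distrib]

lemma codebookMean_div (F : (Fin n → U) → (J → Fin n → V) → (J' → Fin n → V') → ℝ) (c : ℝ) :
    codebookMean pU p p' (fun u C C' => F u C C' / c) = codebookMean pU p p' F / c := by
  simp only [codebookMean, ← mul_div_assoc, ← Finset.sum_div]

lemma codebookMean_comm (pU : U → ℝ) (p : U → V → ℝ) (p' : U → V' → ℝ)
    (F : (Fin n → U) → (J → Fin n → V) → (J' → Fin n → V') → ℝ) :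
    codebookMean pU p p' F = codebookMean pU p' p fun u C' C => F u C C' := by
  refine Finset.sum_congr rfl fun u _ => ?_
  simp only [Finset.mul_sum]
  rw [Finset.sum_comm]
  refine Finset.sum_congr rfl fun C _ => Finset.sum_congr rfl fun C' _ => ?_
  ring

lemma lt_sum_mul_of_mem_stdSimplex {ι : Type*} [Fintype ι] {w f : ι → ℝ} (hw : w ∈ stdSimplex ℝ ι)
    {c : ℝ} (h : ∀ i, c < f i) : c < ∑ i, w i * f i := by
  obtain ⟨i, hi⟩ : ∃ i, w i ≠ 0 := by
    by_contra! h0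
    have := hw.2
    simp [h0] at this
  calc c = ∑ i, w i * c := by rw [← Finset.sum_mul, hw.2, one_mul]
    _ < ∑ i, w i * f i := Finset.sum_lt_sum
        (fun i _ => mul_le_mul_of_nonneg_left (h i).le (hw.1 i))
        ⟨i, Finset.mem_univ i, mul_lt_mul_of_pos_left (h i) ((hw.1 i).lt_of_ne hi.symm)⟩

/-- Only codebooks of positive probability need to be compared. -/
lemma codebookMean_mono (hpU : pU ∈ stdSimplex ℝ U) (hp : ∀ u, p u ∈ stdSimplex ℝ V)
    (hp' : ∀ u, p' u ∈ stdSimplex ℝ V')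
    (h : ∀ u C C', productLaw (fun _ => productLaw fun i => p (u i)) C ≠ 0 →
      productLaw (fun _ => productLaw fun i => p' (u i)) C' ≠ 0 → F u C C' ≤ G u C C') :
    codebookMean pU p p' F ≤ codebookMean pU p p' G := by
  refine Finset.sum_le_sum fun u _ => mul_le_mul_of_nonneg_left (Finset.sum_le_sum fun C _ => ?_)
    (productLaw_nonneg (fun _ => hpU.1) u)
  have hP := productLaw_mem (ι := J) fun _ => productLaw_mem fun i => hp (u i)
  have hP' := productLaw_mem (ι := J') fun _ => productLaw_mem fun i => hp' (u i)
  by_cases hC : productLaw (fun _ => productLaw fun i => p (u i)) C = 0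
  · simp [hC]
  refine mul_le_mul_of_nonneg_left (Finset.sum_le_sum fun C' _ => ?_) (hP.1 C)
  by_cases hC' : productLaw (fun _ => productLaw fun i => p' (u i)) C' = 0
  · simp [hC']
  exact mul_le_mul_of_nonneg_left (h u C C' hC hC') (hP'.1 C')

lemma exists_le_of_codebookMean_le (hpU : pU ∈ stdSimplex ℝ U) (hp : ∀ u, p u ∈ stdSimplex ℝ V)
    (hp' : ∀ u, p' u ∈ stdSimplex ℝ V')
    {c : ℝ} (h : codebookMean pU p p' F ≤ c) :
    ∃ u C C', F u C C' ≤ c := by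
  by_contra! hcon
  have hP := fun u : Fin n → U =>
    productLaw_mem (ι := J) fun _ => productLaw_mem fun i => hp (u i)
  have hP' := fun u : Fin n → U =>
    productLaw_mem (ι := J') fun _ => productLaw_mem fun i => hp' (u i)
  have hPU := productLaw_mem (ι := Fin n) fun _ => hpU
  refine absurd h (not_le.2 ?_)
  exact lt_sum_mul_of_mem_stdSimplex (productLaw_mem fun _ => hpU) fun u =>
    lt_sum_mul_of_mem_stdSimplex (hP u) fun C =>
      lt_sum_mul_of_mem_stdSimplex (hP' u) fun C' => hcon u C C'

/-- The channel seen by a receiver which treats the other user's input as noise. -/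
noncomputable def averagedKernel {U V V' Y : Type*} [Fintype V'] (p' : U → V' → ℝ) (A : V → V' → Y → ℝ) (u : U) (v : V) (y : Y) :
    ℝ :=
  ∑ v', p' u v' * A v v' y

lemma averagedKernel_mem {U V V' Y : Type*} [Fintype V'] [Fintype Y] {p' : U → V' → ℝ}
    {A : V → V' → Y → ℝ} (hp' : ∀ u, p' u ∈ stdSimplex ℝ V')
    (hA : ∀ v v', A v v' ∈ stdSimplex ℝ Y) (u : U) (v : V) :
    averagedKernel p' A u v ∈ stdSimplex ℝ Y :=
  outLaw_mem (p := fun s : U × V => p' s.1) (B := fun s v' => A s.2 v') (fun s => hp' s.1)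
    (fun s v' => hA s.2 v') (u, v)

/-- Averaging over the interfering codeword turns the block channel into the memoryless extension of
the averaged kernel. -/
lemma sum_blockChannel {U V V' Y : Type*} [Fintype V'] (p' : U → V' → ℝ) (A : V → V' → Y → ℝ) (u : Fin n → U) (v : Fin n → V)
    (y : Fin n → Y) :
    ∑ v', productLaw (fun i => p' (u i)) v' * blockChannel A v' v y =
      productLaw (fun i => averagedKernel p' A (u i) (v i)) y :=
  sum_productLaw_mul_productLaw (fun s : U × V => p' s.1) (fun s v' => A s.2 v')
    (fun i => (u i, v i)) y

/-- The threshold decoder of a receiver for a codebook, at the rate `r`. -/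
noncomputable def rateDecoder {U V V' J Y : Type*} [Fintype V] [Fintype V'] [Nonempty J] {n : ℕ}
    (p : U → V → ℝ) (p' : U → V' → ℝ) (A : V → V' → Y → ℝ) (r : ℝ) (u : Fin n → U)
    (C : J → Fin n → V) (y : Fin n → Y) : J :=
  thresholdDecoder (fun (v : Fin n → V) y => productLaw (fun i => averagedKernel p' A (u i) (v i)) y)
    (fun y => productLaw (fun i => outLaw p (averagedKernel p' A) (u i)) y) (2 ^ (n * r)) C y

/-- Reliability: the mean error probability of the threshold decoder vanishes if the rate of the
codebook is below `I(V;Y|U)`, the other user's codewords being averaged into the channel. -/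
lemma codebookMean_error_le [Nonempty J] [Nonempty J'] (hpU : pU ∈ stdSimplex ℝ U)
    (hp : ∀ u, p u ∈ stdSimplex ℝ V) (hp' : ∀ u, p' u ∈ stdSimplex ℝ V') {A : V → V' → Y → ℝ}
    (hA : ∀ v v', A v v' ∈ stdSimplex ℝ Y) {δ : ℝ} (hδ : 0 < δ) (hn : 0 < n) :
    codebookMean (n := n) (J := J) (J' := J') pU p p' (fun u C C' =>
      codebookError A (rateDecoder p p' A (meanInfo pU p (averagedKernel p' A) - δ) u C) C C') ≤
      varInfo pU p (averagedKernel p' A) / (n * δ ^ 2) +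
        (Fintype.card J - 1) / 2 ^ (n * (meanInfo pU p (averagedKernel p' A) - δ)) := by
  set I := meanInfo pU p (averagedKernel p' A)
  have hJ : (0 : ℝ) < Fintype.card J := Nat.cast_pos.2 Fintype.card_pos
  have hJ' : (0 : ℝ) < Fintype.card J' := Nat.cast_pos.2 Fintype.card_pos
  have hT := averagedKernel_mem hp' hA
  have hPU := productLaw_mem (ι := Fin n) fun _ => hpU
  set b : (Fin n → U) → ℝ := fun u => ∑ v, productLaw (fun i => p (u i)) v *
    ∑ y : Fin n → Y, productLaw (fun i => averagedKernel p' A (u i) (v i)) y *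
      (if productLaw (fun i => averagedKernel p' A (u i) (v i)) y ≤
        2 ^ (n * (I - δ)) * productLaw (fun i => outLaw p (averagedKernel p' A) (u i)) y
        then 1 else 0) with hb
  have hC' : ∀ (u : Fin n → U) (C : J → Fin n → V),
      ∑ C' : J' → Fin n → V', productLaw (fun _ => productLaw fun i => p' (u i)) C' *
        (1 / (Fintype.card J : ℝ) * ∑ j, 1 / (Fintype.card J' : ℝ) * ∑ k, ∑ y,
          blockChannel A (C' k) (C j) y *
            (if rateDecoder p p' A (I - δ) u C y ≠ j then 1 else 0)) =
      1 / (Fintype.card J : ℝ) * ∑ j, ∑ y,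
        productLaw (fun i => averagedKernel p' A (u i) (C j i)) y *
          (if rateDecoder p p' A (I - δ) u C y ≠ j then 1 else 0) := by
    intro u C
    have hk : ∀ (j : J) (y : Fin n → Y) (k : J'),
        ∑ C' : J' → Fin n → V', productLaw (fun _ => productLaw fun i => p' (u i)) C' *
          (blockChannel A (C' k) (C j) y *
            (if rateDecoder p p' A (I - δ) u C y ≠ j then 1 else 0)) =
        productLaw (fun i => averagedKernel p' A (u i) (C j i)) y *
          (if rateDecoder p p' A (I - δ) u C y ≠ j then 1 else 0) := by
      intro j y k
      rw [sum_productLaw_single (p := fun _ : J' => productLaw fun i => p' (u i))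
        (fun _ => (productLaw_mem fun i => hp' (u i)).2) k
        fun v' => blockChannel A v' (C j) y *
          (if rateDecoder p p' A (I - δ) u C y ≠ j then 1 else 0)]
      simp only [← mul_assoc, ← Finset.sum_mul]
      rw [sum_blockChannel]
    have h1 : ∑ C' : J' → Fin n → V', productLaw (fun _ => productLaw fun i => p' (u i)) C' *
        (1 / (Fintype.card J : ℝ) * ∑ j, 1 / (Fintype.card J' : ℝ) * ∑ k, ∑ y,
          blockChannel A (C' k) (C j) y *
            (if rateDecoder p p' A (I - δ) u C y ≠ j then 1 else 0)) =
        1 / (Fintype.card J : ℝ) * ∑ j, 1 / (Fintype.card J' : ℝ) * ∑ k, ∑ y,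
          ∑ C' : J' → Fin n → V', productLaw (fun _ => productLaw fun i => p' (u i)) C' *
            (blockChannel A (C' k) (C j) y *
              (if rateDecoder p p' A (I - δ) u C y ≠ j then 1 else 0)) := by
      simp only [Finset.mul_sum]
      rw [Finset.sum_comm]
      refine Finset.sum_congr rfl fun j _ => ?_
      rw [Finset.sum_comm]
      refine Finset.sum_congr rfl fun k _ => ?_
      rw [Finset.sum_comm]
      refine Finset.sum_congr rfl fun y _ => Finset.sum_congr rfl fun C' _ => ?_
      ring
    rw [h1]
    refine congrArg _ (Finset.sum_congr rfl fun j _ => ?_)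
    rw [Finset.sum_congr rfl fun k _ => Finset.sum_congr rfl fun y _ => hk j y k, Finset.sum_const,
      Finset.card_univ, nsmul_eq_mul, ← mul_assoc, one_div_mul_cancel hJ'.ne', one_mul]
  have hC : ∀ u : Fin n → U, ∑ C : J → Fin n → V,
      productLaw (fun _ => productLaw fun i => p (u i)) C *
        (1 / (Fintype.card J : ℝ) * ∑ j, ∑ y,
          productLaw (fun i => averagedKernel p' A (u i) (C j i)) y *
            (if rateDecoder p p' A (I - δ) u C y ≠ j then 1 else 0)) ≤
      b u + (Fintype.card J - 1) / 2 ^ (n * (I - δ)) := by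
    intro u
    have h1 : ∀ j : J, _ := fun j => sum_error_le (μ := productLaw fun i => p (u i))
      (productLaw_mem fun i => hp (u i))
      (T := fun (v : Fin n → V) y => productLaw (fun i => averagedKernel p' A (u i) (v i)) y)
      (fun v => productLaw_mem fun i => hT (u i) (v i))
      (sum_productLaw_mul_productLaw p (averagedKernel p' A) u)
      (θ := 2 ^ (n * (I - δ))) (by positivity) j
    have h2 : ∑ C : J → Fin n → V,
      productLaw (fun _ => productLaw fun i => p (u i)) C *
        (1 / (Fintype.card J : ℝ) * ∑ j, ∑ y,
          productLaw (fun i => averagedKernel p' A (u i) (C j i)) y *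
            (if rateDecoder p p' A (I - δ) u C y ≠ j then 1 else 0)) =
        1 / (Fintype.card J : ℝ) * ∑ j, ∑ C : J → Fin n → V,
          productLaw (fun _ => productLaw fun i => p (u i)) C * ∑ y,
          productLaw (fun i => averagedKernel p' A (u i) (C j i)) y *
            (if rateDecoder p p' A (I - δ) u C y ≠ j then 1 else 0) := by
      rw [Finset.sum_comm, Finset.mul_sum]
      refine Finset.sum_congr rfl fun C _ => ?_
      rw [← Finset.mul_sum]
      ring
    rw [h2]
    refine (mul_le_mul_of_nonneg_left (Finset.sum_le_sum fun j _ => h1 j)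
      (by positivity)).trans_eq ?_
    rw [Finset.sum_const, Finset.card_univ, nsmul_eq_mul, ← mul_assoc,
      one_div_mul_cancel hJ.ne', one_mul]
  simp only [codebookMean, codebookError, hC']
  refine (Finset.sum_le_sum fun u _ => mul_le_mul_of_nonneg_left (hC u) (hPU.1 u)).trans ?_
  simp only [mul_add, Finset.sum_add_distrib, ← Finset.sum_mul, hPU.2, one_mul]
  exact add_le_add_left (atypical_le hpU hp hT hδ hn) _

/-- The mean over the message `w` and the index `k` of the interfering codeword of the divergence
between the output of the codewords reserved for `w` and the output of the random coding law, both
given the interfering codeword. -/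
noncomputable def codebookDivergence {U V V' J' Y : Type*} [Fintype V] [Fintype J'] [Fintype Y]
    {n M L : ℕ} (p : U → V → ℝ) (A : V → V' → Y → ℝ) (u : Fin n → U)
    (C : Fin M × Fin L → Fin n → V) (C' : J' → Fin n → V') : ℝ :=
  1 / (M : ℝ) * ∑ w, 1 / (Fintype.card J' : ℝ) * ∑ k,
    mixtureDivergence (blockChannel A (C' k))
      (fun y => productLaw
        (fun i => outLaw (fun s : V' × U => p s.2) (fun s v => A v s.1) (C' k i, u i)) y)
      fun l => C (w, l)

/-- Secrecy: the mean divergence which bounds the leakage, for a receiver which knows the other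
user's codeword and faces `L` codewords for each message. It is negligible if the rate of `L`
is close to `I(V;Y|V',U)`. -/
lemma codebookMean_divergence_le [Nonempty J'] [NeZero M] [NeZero L] (hpU : pU ∈ stdSimplex ℝ U)
    (hp : ∀ u, p u ∈ stdSimplex ℝ V) (hp' : ∀ u, p' u ∈ stdSimplex ℝ V') {A : V → V' → Y → ℝ}
    (hA : ∀ v v', A v v' ∈ stdSimplex ℝ Y) {δ : ℝ} (hδ : 0 < δ) (hn : 0 < n) :
    codebookMean (n := n) (J := Fin M × Fin L) (J' := J') pU p p' (codebookDivergence p A) ≤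
      1 + max 0 (n * meanInfo (fun s : V' × U => pU s.2 * p' s.2 s.1) (fun s => p s.2)
          (fun s v => A v s.1) - Real.logb 2 L) +
        varInfo (fun s : V' × U => pU s.2 * p' s.2 s.1) (fun s => p s.2) (fun s v => A v s.1) /
          (2 * δ) + n * δ / 2 := by
  have hM : (0 : ℝ) < M := Nat.cast_pos.2 (NeZero.pos M)
  have hL : (0 : ℝ) < L := Nat.cast_pos.2 (NeZero.pos L)
  have hJ' : (0 : ℝ) < Fintype.card J' := Nat.cast_pos.2 Fintype.card_pos
  set pS : V' × U → V → ℝ := fun s => p s.2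
  set B : V' × U → V → Y → ℝ := fun s v => A v s.1
  set π : V' × U → ℝ := fun s => pU s.2 * p' s.2 s.1 with hπdef
  have hpS : ∀ s, pS s ∈ stdSimplex ℝ V := fun s => hp s.2
  have hB : ∀ s v, B s v ∈ stdSimplex ℝ Y := fun s v => hA v s.1
  have hπ : π ∈ stdSimplex ℝ (V' × U) := mul_mem_stdSimplex hpU hp'
  have hPU := productLaw_mem (ι := Fin n) fun _ => hpU
  have hP' := fun u : Fin n → U =>
    productLaw_mem (ι := J') fun _ => productLaw_mem fun i => hp' (u i)
  set φ : (Fin n → V') → (Fin n → U) → ℝ := fun v' u =>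
    ∑ v, productLaw (fun i => pS (v' i, u i)) v * ∑ y : Fin n → Y,
      productLaw (fun i => B (v' i, u i) (v i)) y *
        Real.logb 2 (1 + productLaw (fun i => B (v' i, u i) (v i)) y /
          productLaw (fun i => outLaw pS B (v' i, u i)) y / L) with hφ
  set D : (Fin n → U) → (Fin M × Fin L → Fin n → V) → (J' → Fin n → V') → Fin M → J' → ℝ :=
    fun u C C' w k => mixtureDivergence (blockChannel A (C' k))
      (fun y => productLaw (fun i => outLaw pS B (C' k i, u i)) y) fun l => C (w, l) with hD
  have hcover : ∀ (u : Fin n → U) (C' : J' → Fin n → V') (w : Fin M) (k : J'),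
      ∑ C : Fin M × Fin L → Fin n → V, productLaw (fun _ => productLaw fun i => p (u i)) C *
        D u C C' w k ≤ φ (C' k) u := by
    intro u C' w k
    have := sum_mixtureDivergence_le (J := Fin M × Fin L) (Λ := Fin L) (e := fun l => (w, l))
      (fun l l' h => (Prod.mk.inj h).2) (μ := productLaw fun i => p (u i))
      (productLaw_mem fun i => hp (u i)) (T := blockChannel A (C' k))
      (fun v => productLaw_mem fun i => hA (v i) (C' k i))
      (q := fun y => productLaw (fun i => outLaw pS B (C' k i, u i)) y)
      (sum_productLaw_mul_productLaw pS B fun i => (C' k i, u i))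
    rw [Fintype.card_fin] at this
    exact this
  have hinner : ∀ (u : Fin n → U) (C' : J' → Fin n → V'),
      ∑ C : Fin M × Fin L → Fin n → V, productLaw (fun _ => productLaw fun i => p (u i)) C *
        (1 / (M : ℝ) * ∑ w, 1 / (Fintype.card J' : ℝ) * ∑ k, D u C C' w k) ≤
      1 / (Fintype.card J' : ℝ) * ∑ k, φ (C' k) u := by
    intro u C'
    have h1 : ∑ C : Fin M × Fin L → Fin n → V, productLaw (fun _ => productLaw fun i => p (u i)) C *
        (1 / (M : ℝ) * ∑ w, 1 / (Fintype.card J' : ℝ) * ∑ k, D u C C' w k) =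
        1 / (M : ℝ) * ∑ w, 1 / (Fintype.card J' : ℝ) * ∑ k,
          ∑ C : Fin M × Fin L → Fin n → V,
            productLaw (fun _ => productLaw fun i => p (u i)) C * D u C C' w k := by
      simp only [Finset.mul_sum]
      rw [Finset.sum_comm]
      refine Finset.sum_congr rfl fun w _ => ?_
      rw [Finset.sum_comm]
      refine Finset.sum_congr rfl fun k _ => Finset.sum_congr rfl fun C _ => ?_
      ring
    rw [h1]
    refine (mul_le_mul_of_nonneg_left (Finset.sum_le_sum fun w _ => mul_le_mul_of_nonneg_left
      (Finset.sum_le_sum fun k _ => hcover u C' w k) (by positivity)) (by positivity)).trans_eq ?_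
    rw [Finset.sum_const, Finset.card_univ, Fintype.card_fin, nsmul_eq_mul, ← mul_assoc,
      one_div_mul_cancel hM.ne', one_mul]
  rw [codebookMean_comm]
  refine (Finset.sum_le_sum fun u _ => mul_le_mul_of_nonneg_left (Finset.sum_le_sum fun C' _ =>
    mul_le_mul_of_nonneg_left (hinner u C') ((hP' u).1 C')) (hPU.1 u)).trans ?_
  have hmarg : ∀ u : Fin n → U, ∑ C' : J' → Fin n → V',
      productLaw (fun _ => productLaw fun i => p' (u i)) C' *
        (1 / (Fintype.card J' : ℝ) * ∑ k, φ (C' k) u) =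
      ∑ v', productLaw (fun i => p' (u i)) v' * φ v' u := by
    intro u
    have h1 : ∑ C' : J' → Fin n → V', productLaw (fun _ => productLaw fun i => p' (u i)) C' *
        (1 / (Fintype.card J' : ℝ) * ∑ k, φ (C' k) u) =
        1 / (Fintype.card J' : ℝ) * ∑ k, ∑ C' : J' → Fin n → V',
          productLaw (fun _ => productLaw fun i => p' (u i)) C' * φ (C' k) u := by
      rw [Finset.sum_comm, Finset.mul_sum]
      refine Finset.sum_congr rfl fun C' _ => ?_
      rw [← Finset.mul_sum]
      ring
    have h2 : ∀ k : J', ∑ C' : J' → Fin n → V',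
        productLaw (fun _ => productLaw fun i => p' (u i)) C' * φ (C' k) u =
        ∑ v', productLaw (fun i => p' (u i)) v' * φ v' u := fun k =>
      sum_productLaw_single (p := fun _ : J' => productLaw fun i => p' (u i))
        (fun _ => (productLaw_mem fun i => hp' (u i)).2) k fun v' => φ v' u
    rw [h1, Finset.sum_congr rfl fun k _ => h2 k, Finset.sum_const, Finset.card_univ, nsmul_eq_mul,
      ← mul_assoc, one_div_mul_cancel hJ'.ne', one_mul]
  rw [Finset.sum_congr rfl fun u _ => congrArg _ (hmarg u)]
  refine le_of_eq_of_le ?_ (sum_logb_one_add_le hπ hpS hB hδ hL hn)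
  have h1 := sum_arrow_prod (ι := Fin n) (α := V') (β := U) fun v' u =>
    productLaw (fun _ => π) (fun i => (v' i, u i)) * φ v' u
  refine Eq.trans ?_ h1.symm
  rw [Finset.sum_comm]
  refine Finset.sum_congr rfl fun u _ => ?_
  rw [Finset.mul_sum]
  refine Finset.sum_congr rfl fun v' _ => ?_
  simp only [productLaw, hπdef, Finset.prod_mul_distrib]
  ring

/-- On codebooks of positive probability, the divergences bound the leakage of the message about a
receiver with output law `P(y|w) = 1 / |J'| ∑ₖ P(y|w,k)`. -/
lemma logb_sub_condEntropy_le_codebookDivergence {Ω U V V' J' Y : Type*} [Fintype Ω] [Fintype V]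
    [Fintype J'] [Fintype Y] [Nonempty J'] [NeZero M] [NeZero L] {p : U → V → ℝ}
    (hp : ∀ u, p u ∈ stdSimplex ℝ V) {A : V → V' → Y → ℝ}
    (hA : ∀ v v', A v v' ∈ stdSimplex ℝ Y) {u : Fin n → U} {C : Fin M × Fin L → Fin n → V}
    {C' : J' → Fin n → V'} (hC : productLaw (fun _ => productLaw fun i => p (u i)) C ≠ 0)
    {P : Ω → ℝ} {X : Ω → Fin M} {Z : Ω → Fin n → Y}
    (h : ∀ w y, law P (fun ω => (X ω, Z ω)) (w, y) = 1 / ((M : ℝ) * Fintype.card J') *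
      ∑ k, mixture (blockChannel A (C' k)) (fun l => C (w, l)) y) :
    Real.logb 2 M - condEntropy P X Z ≤ codebookDivergence p A u C C' := by
  have hT : ∀ k v, blockChannel A (C' k) v ∈ stdSimplex ℝ (Fin n → Y) := fun k v =>
    productLaw_mem fun i => hA (v i) (C' k i)
  refine logb_sub_condEntropy_le (Q := fun w k => mixture (blockChannel A (C' k)) fun l => C (w, l))
    (fun w k => mixture_mem (hT k) _)
    (q := fun k y => productLaw
      (fun i => outLaw (fun s : V' × U => p s.2) (fun s v => A v s.1) (C' k i, u i)) y)
    (fun k => productLaw_mem fun i => outLaw_mem (fun s : V' × U => hp s.2)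
      (fun (s : V' × U) v => hA v s.1) _) ?_ h
  intro w k y h0
  rw [← sum_productLaw_mul_productLaw (fun s : V' × U => p s.2) (fun s v => A v s.1)
    (fun i => (C' k i, u i)) y] at h0
  change ∑ v, productLaw (fun i => p (u i)) v * blockChannel A (C' k) v y = 0 at h0
  rw [Finset.sum_eq_zero_iff_of_nonneg fun v _ => mul_nonneg
    (productLaw_nonneg (fun i => (hp (u i)).1) v) ((hT k v).1 y)] at h0
  refine mul_eq_zero_of_right _ (Finset.sum_eq_zero fun l _ => ?_)
  exact (mul_eq_zero.1 (h0 (C (w, l)) (Finset.mem_univ _))).resolve_left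
    (Finset.prod_ne_zero_iff.1 hC (w, l) (Finset.mem_univ _))

end RandomCodebooks

/-! ### The single-letter informations -/

section SingleLetter

variable {X₁ X₂ Y₁ Y₂ U V₁ V₂ : Type*} [Fintype X₁] [Fintype X₂] [Fintype Y₁] [Fintype Y₂]
  [Fintype U] [Fintype V₁] [Fintype V₂]
  {W : X₁ → X₂ → Y₁ × Y₂ → ℝ} {P : U × V₁ × V₂ × X₁ × X₂ × Y₁ × Y₂ → ℝ}
  {pU : U → ℝ} {p₁ : U → V₁ → ℝ} {p₂ : U → V₂ → ℝ} {q₁ : V₁ → X₁ → ℝ} {q₂ : V₂ → X₂ → ℝ}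

open Classical in
/-- Laws of functions of `(U, V₁, V₂, Y₁)`, the channel inputs and `Y₂` being summed out. -/
lemma law_of_first_output
    (hP : ∀ u v₁ v₂ x₁ x₂ y₁ y₂, P (u, v₁, v₂, x₁, x₂, y₁, y₂) =
      pU u * p₁ u v₁ * p₂ u v₂ * q₁ v₁ x₁ * q₂ v₂ x₂ * W x₁ x₂ (y₁, y₂))
    {γ : Type*} (g : U → V₁ → V₂ → Y₁ → γ) (a : γ) :
    law P (fun ω => g (rvU ω) (rvV₁ ω) (rvV₂ ω) (rvY₁ ω)) a =
      ∑ u, ∑ v₁, ∑ v₂, ∑ y₁, if g u v₁ v₂ y₁ = a then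
        pU u * p₁ u v₁ * p₂ u v₂ * auxChannel₁ q₁ q₂ W v₁ v₂ y₁ else 0 := by
  simp only [law, Fintype.sum_prod_type, rvU, rvV₁, rvV₂, rvY₁, hP]
  refine Finset.sum_congr rfl fun u _ => Finset.sum_congr rfl fun v₁ _ =>
    Finset.sum_congr rfl fun v₂ _ => ?_
  rw [Finset.sum_congr rfl fun x₁ _ => Finset.sum_comm, Finset.sum_comm]
  refine Finset.sum_congr rfl fun y₁ _ => ?_
  split_ifs
  · simp only [auxChannel₁, auxChannel, Finset.mul_sum]
    rw [Finset.sum_congr rfl fun x₁ _ => Finset.sum_comm, Finset.sum_comm]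
    refine Finset.sum_congr rfl fun y₂ _ => Finset.sum_congr rfl fun x₁ _ =>
      Finset.sum_congr rfl fun x₂ _ => ?_
    ring
  · simp

open Classical in
lemma law_of_second_output
    (hP : ∀ u v₁ v₂ x₁ x₂ y₁ y₂, P (u, v₁, v₂, x₁, x₂, y₁, y₂) =
      pU u * p₁ u v₁ * p₂ u v₂ * q₁ v₁ x₁ * q₂ v₂ x₂ * W x₁ x₂ (y₁, y₂))
    {γ : Type*} (g : U → V₁ → V₂ → Y₂ → γ) (a : γ) :
    law P (fun ω => g (rvU ω) (rvV₁ ω) (rvV₂ ω) (rvY₂ ω)) a =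
      ∑ u, ∑ v₁, ∑ v₂, ∑ y₂, if g u v₁ v₂ y₂ = a then
        pU u * p₁ u v₁ * p₂ u v₂ * auxChannel₂ q₁ q₂ W v₁ v₂ y₂ else 0 := by
  simp only [law, Fintype.sum_prod_type, rvU, rvV₁, rvV₂, rvY₂, hP]
  refine Finset.sum_congr rfl fun u _ => Finset.sum_congr rfl fun v₁ _ =>
    Finset.sum_congr rfl fun v₂ _ => ?_
  rw [Finset.sum_congr rfl fun x₁ _ => Finset.sum_congr rfl fun x₂ _ => Finset.sum_comm,
    Finset.sum_congr rfl fun x₁ _ => Finset.sum_comm, Finset.sum_comm]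
  refine Finset.sum_congr rfl fun y₂ _ => ?_
  split_ifs
  · simp only [auxChannel₂, auxChannel, Finset.mul_sum]
    rw [Finset.sum_congr rfl fun x₁ _ => Finset.sum_comm, Finset.sum_comm]
    refine Finset.sum_congr rfl fun y₁ _ => Finset.sum_congr rfl fun x₁ _ =>
      Finset.sum_congr rfl fun x₂ _ => ?_
    ring
  · simp

/-- `I(V₁;Y₁|U)` is the mean information density of the channel in which `V₂` is averaged out. -/
lemma condMutualInfo_intended₁ (hp₁ : ∀ u, p₁ u ∈ stdSimplex ℝ V₁)
    (hp₂ : ∀ u, p₂ u ∈ stdSimplex ℝ V₂) (hq₁ : ∀ v, q₁ v ∈ stdSimplex ℝ X₁)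
    (hq₂ : ∀ v, q₂ v ∈ stdSimplex ℝ X₂) (hW : IsChannel W)
    (hP : ∀ u v₁ v₂ x₁ x₂ y₁ y₂, P (u, v₁, v₂, x₁, x₂, y₁, y₂) =
      pU u * p₁ u v₁ * p₂ u v₂ * q₁ v₁ x₁ * q₂ v₂ x₂ * W x₁ x₂ (y₁, y₂)) :
    condMutualInfo P rvV₁ rvY₁ rvU =
    meanInfo pU p₁ (averagedKernel p₂ (auxChannel₁ q₁ q₂ W)) := by
  classical
  refine condMutualInfo_eq_meanInfo hp₁ (averagedKernel_mem hp₂ (auxChannel₁_mem hq₁ hq₂ hW)) ?_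
  intro u v y
  rw [law_of_first_output hP fun u v₁ _ y₁ => (v₁, (y₁, u)),
    Finset.sum_eq_single u (fun u' _ h => by simp [h]) (by simp),
    Finset.sum_eq_single v (fun v' _ h => by simp [h]) (by simp), averagedKernel, Finset.mul_sum]
  refine Finset.sum_congr rfl fun v₂ _ => ?_
  rw [Finset.sum_eq_single y (fun y' _ h => by simp [h]) (by simp), if_pos rfl]
  ring

lemma condMutualInfo_intended₂ (hp₁ : ∀ u, p₁ u ∈ stdSimplex ℝ V₁)
    (hp₂ : ∀ u, p₂ u ∈ stdSimplex ℝ V₂) (hq₁ : ∀ v, q₁ v ∈ stdSimplex ℝ X₁)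
    (hq₂ : ∀ v, q₂ v ∈ stdSimplex ℝ X₂) (hW : IsChannel W)
    (hP : ∀ u v₁ v₂ x₁ x₂ y₁ y₂, P (u, v₁, v₂, x₁, x₂, y₁, y₂) =
      pU u * p₁ u v₁ * p₂ u v₂ * q₁ v₁ x₁ * q₂ v₂ x₂ * W x₁ x₂ (y₁, y₂)) :
    condMutualInfo P rvV₂ rvY₂ rvU =
    meanInfo pU p₂ (averagedKernel p₁ fun v₂ v₁ => auxChannel₂ q₁ q₂ W v₁ v₂) := by
  classical
  refine condMutualInfo_eq_meanInfo hp₂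
    (averagedKernel_mem hp₁ fun v₂ v₁ => auxChannel₂_mem hq₁ hq₂ hW v₁ v₂) ?_
  intro u v y
  rw [law_of_second_output hP fun u _ v₂ y₂ => (v₂, (y₂, u)),
    Finset.sum_eq_single u (fun u' _ h => by simp [h]) (by simp), averagedKernel, Finset.mul_sum]
  refine Finset.sum_congr rfl fun v₁ _ => ?_
  rw [Finset.sum_eq_single v (fun v' _ h => by simp [h]) (by simp),
    Finset.sum_eq_single y (fun y' _ h => by simp [h]) (by simp), if_pos rfl]
  ring

/-- `I(V₁;Y₂|V₂,U)` is the mean information density of the channel to the second receiver, with the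
pair `(V₂, U)` as its state. -/
lemma condMutualInfo_penalty₁ (hp₁ : ∀ u, p₁ u ∈ stdSimplex ℝ V₁) (hq₁ : ∀ v, q₁ v ∈ stdSimplex ℝ X₁)
    (hq₂ : ∀ v, q₂ v ∈ stdSimplex ℝ X₂) (hW : IsChannel W)
    (hP : ∀ u v₁ v₂ x₁ x₂ y₁ y₂, P (u, v₁, v₂, x₁, x₂, y₁, y₂) =
      pU u * p₁ u v₁ * p₂ u v₂ * q₁ v₁ x₁ * q₂ v₂ x₂ * W x₁ x₂ (y₁, y₂)) :
    condMutualInfo P rvV₁ rvY₂ (fun ω => (rvV₂ ω, rvU ω)) =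
    meanInfo (fun s : V₂ × U => pU s.2 * p₂ s.2 s.1) (fun s => p₁ s.2)
      (fun s v => auxChannel₂ q₁ q₂ W v s.1) := by
  classical
  refine condMutualInfo_eq_meanInfo (fun s => hp₁ s.2)
    (fun s v => auxChannel₂_mem hq₁ hq₂ hW v s.1) ?_
  rintro ⟨v₂, u⟩ v y
  rw [law_of_second_output hP fun u v₁ v₂ y₂ => (v₁, (y₂, (v₂, u))),
    Finset.sum_eq_single u (fun u' _ h => by simp [h]) (by simp),
    Finset.sum_eq_single v (fun v' _ h => by simp [h]) (by simp),
    Finset.sum_eq_single v₂ (fun v' _ h => by simp [h]) (by simp),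
    Finset.sum_eq_single y (fun y' _ h => by simp [h]) (by simp), if_pos rfl]
  ring

lemma condMutualInfo_penalty₂ (hp₂ : ∀ u, p₂ u ∈ stdSimplex ℝ V₂) (hq₁ : ∀ v, q₁ v ∈ stdSimplex ℝ X₁)
    (hq₂ : ∀ v, q₂ v ∈ stdSimplex ℝ X₂) (hW : IsChannel W)
    (hP : ∀ u v₁ v₂ x₁ x₂ y₁ y₂, P (u, v₁, v₂, x₁, x₂, y₁, y₂) =
      pU u * p₁ u v₁ * p₂ u v₂ * q₁ v₁ x₁ * q₂ v₂ x₂ * W x₁ x₂ (y₁, y₂)) :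
    condMutualInfo P rvV₂ rvY₁ (fun ω => (rvV₁ ω, rvU ω)) =
    meanInfo (fun s : V₁ × U => pU s.2 * p₁ s.2 s.1) (fun s => p₂ s.2)
      (fun s v => auxChannel₁ q₁ q₂ W s.1 v) := by
  classical
  refine condMutualInfo_eq_meanInfo (fun s => hp₂ s.2)
    (fun s v => auxChannel₁_mem hq₁ hq₂ hW s.1 v) ?_
  rintro ⟨v₁, u⟩ v y
  rw [law_of_first_output hP fun u v₁ v₂ y₁ => (v₂, (y₁, (v₁, u))),
    Finset.sum_eq_single u (fun u' _ h => by simp [h]) (by simp),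
    Finset.sum_eq_single v₁ (fun v' _ h => by simp [h]) (by simp),
    Finset.sum_eq_single v (fun v' _ h => by simp [h]) (by simp),
    Finset.sum_eq_single y (fun y' _ h => by simp [h]) (by simp), if_pos rfl]

end SingleLetter

/-! ### Choice of the rates and the block length -/

/-- The number of codewords of a user with `⌈2 ^ (n R)⌉` messages and `⌈2 ^ (n (S - 2δ))⌉` codewords
for each, `S` being the secrecy penalty. A user with `R = 0` has a single message, hence the codebook
stays below the rate `I` even if `I = S`; one with `S = 0` has a single codeword for each message. -/
lemma exists_codebook_size_le {R I S : ℝ} (hR : 0 ≤ R) (h : R ≤ I - S) (h' : R = 0 ∨ R < I) :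
    ∃ δ₀ : ℝ, 0 < δ₀ ∧ ∀ δ : ℝ, 0 < δ → δ ≤ δ₀ → ∀ n : ℕ,
      (⌈(2 : ℝ) ^ (n * R)⌉₊ : ℝ) * ⌈(2 : ℝ) ^ (n * (S - 2 * δ))⌉₊ - 1 ≤
        4 * 2 ^ (n * (I - 2 * δ)) := by
  have hmono : ∀ {a b : ℝ} (n : ℕ), a ≤ b → (2 : ℝ) ^ (n * a) ≤ 2 ^ (n * b) := fun n hab =>
    Real.rpow_le_rpow_of_exponent_le one_le_two (mul_le_mul_of_nonneg_left hab n.cast_nonneg)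
  have hceil : ∀ a : ℝ, (⌈(2 : ℝ) ^ a⌉₊ : ℝ) ≤ 2 ^ a + 1 := fun a =>
    (Nat.ceil_lt_add_one (by positivity)).le
  rcases h' with rfl | hRI
  · refine ⟨1, one_pos, fun δ _ _ n => ?_⟩
    have h1 := hceil (n * (S - 2 * δ))
    have h2 := hmono n (show S - 2 * δ ≤ I - 2 * δ by linarith)
    have h3 : (0 : ℝ) < 2 ^ (n * (I - 2 * δ)) := by positivity
    simp only [mul_zero, Real.rpow_zero, Nat.ceil_one, Nat.cast_one, one_mul]
    linarith
  · refine ⟨(I - R) / 2, by linarith, fun δ hδ hδ' n => ?_⟩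
    set z : ℝ := 2 ^ (n * (I - 2 * δ)) with hz
    have h1 : (2 : ℝ) ^ (n * R) ≤ z := hmono n (by linarith)
    have h2 : (2 : ℝ) ^ (n * (S - 2 * δ)) ≤ z := hmono n (by linarith)
    have h3 : (1 : ℝ) ≤ z := Real.one_le_rpow one_le_two
      (mul_nonneg n.cast_nonneg (by linarith))
    have h4 : (2 : ℝ) ^ (n * R) * 2 ^ (n * (S - 2 * δ)) ≤ z := by
      rw [← Real.rpow_add two_pos, ← mul_add]
      exact hmono n (by linarith)
    have h5 := mul_le_mul (hceil (n * R)) (hceil (n * (S - 2 * δ))) (by positivity) (by positivity)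
    nlinarith

lemma exists_block_length (K : ℝ) {δ ε : ℝ} (hδ : 0 < δ) (hε : 0 < ε) :
    ∃ n : ℕ, 0 < n ∧ K / n + 8 * 2 ^ (-(n * δ)) ≤ ε := by
  have h1 : Filter.Tendsto (fun n : ℕ => K / n + 8 * ((2 : ℝ) ^ (-δ)) ^ n) Filter.atTop
      (nhds (0 + 8 * 0)) := by
    refine (tendsto_const_div_atTop_nhds_zero_nat K).add (Filter.Tendsto.const_mul 8 ?_)
    exact tendsto_pow_atTop_nhds_zero_of_lt_one (by positivity)
      (Real.rpow_lt_one_of_one_lt_of_neg one_lt_two (by linarith))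
  rw [mul_zero, add_zero] at h1
  obtain ⟨n, hn, hn0⟩ := ((h1.eventually_le_const hε).and (Filter.eventually_gt_atTop 0)).exists
  refine ⟨n, hn0, ?_⟩
  rwa [← Real.rpow_natCast, ← Real.rpow_mul two_pos.le,
    show -δ * (n : ℝ) = -(n * δ) by ring] at hn

/-! ### Achievability -/

section Achievability

variable {X₁ X₂ Y₁ Y₂ U V₁ V₂ : Type*} [Fintype X₁] [Fintype X₂] [Fintype Y₁] [Fintype Y₂]
  [Fintype U] [Fintype V₁] [Fintype V₂]
  {W : X₁ → X₂ → Y₁ × Y₂ → ℝ}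
  {pU : U → ℝ} {p₁ : U → V₁ → ℝ} {p₂ : U → V₂ → ℝ} {q₁ : V₁ → X₁ → ℝ} {q₂ : V₂ → X₂ → ℝ}

/-- The mean error probability of one user, for a codebook of the size chosen above. -/
lemma codebookMean_error_le_of_card {V V' Y J J' : Type*} [Fintype V] [Fintype V'] [Fintype Y]
    [Fintype J] [Fintype J'] [DecidableEq J] [DecidableEq J'] [Nonempty J] [Nonempty J']
    {p : U → V → ℝ} {p' : U → V' → ℝ} (hpU : pU ∈ stdSimplex ℝ U)
    (hp : ∀ u, p u ∈ stdSimplex ℝ V) (hp' : ∀ u, p' u ∈ stdSimplex ℝ V') {A : V → V' → Y → ℝ}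
    (hA : ∀ v v', A v v' ∈ stdSimplex ℝ Y) {δ : ℝ} (hδ : 0 < δ) {n : ℕ} (hn : 0 < n)
    (hJ : (Fintype.card J : ℝ) - 1 ≤
      4 * 2 ^ (n * (meanInfo pU p (averagedKernel p' A) - 2 * δ))) :
    codebookMean (n := n) (J := J) (J' := J') pU p p' (fun u C C' =>
      codebookError A (rateDecoder p p' A (meanInfo pU p (averagedKernel p' A) - δ) u C) C C') ≤
      varInfo pU p (averagedKernel p' A) / (n * δ ^ 2) + 4 * 2 ^ (-(n * δ)) := by
  refine (codebookMean_error_le hpU hp hp' hA hδ hn).trans (add_le_add_right ?_ _)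
  rw [div_le_iff₀ (by positivity), mul_assoc, ← Real.rpow_add two_pos]
  refine hJ.trans_eq ?_
  congr 2
  ring

/-- The mean leakage bound of one user, for the number of codewords chosen above. -/
lemma codebookMean_divergence_le_of_le {V V' Y J' : Type*} [Fintype V] [Fintype V'] [Fintype Y]
    [Fintype J'] [DecidableEq J'] [Nonempty J'] {M L : ℕ} [NeZero M] [NeZero L]
    {p : U → V → ℝ} {p' : U → V' → ℝ} (hpU : pU ∈ stdSimplex ℝ U)
    (hp : ∀ u, p u ∈ stdSimplex ℝ V) (hp' : ∀ u, p' u ∈ stdSimplex ℝ V') {A : V → V' → Y → ℝ}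
    (hA : ∀ v v', A v v' ∈ stdSimplex ℝ Y) {δ : ℝ} (hδ : 0 < δ) {n : ℕ} (hn : 0 < n)
    (hL : (2 : ℝ) ^ (n * (meanInfo (fun s : V' × U => pU s.2 * p' s.2 s.1) (fun s => p s.2)
      (fun s v => A v s.1) - 2 * δ)) ≤ L) :
    codebookMean (n := n) (J := Fin M × Fin L) (J' := J') pU p p' (codebookDivergence p A) ≤
      1 + varInfo (fun s : V' × U => pU s.2 * p' s.2 s.1) (fun s => p s.2) (fun s v => A v s.1) /
          (2 * δ) + n * (5 / 2 * δ) := by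
  refine (codebookMean_divergence_le hpU hp hp' hA hδ hn).trans ?_
  have h := (Real.le_logb_iff_rpow_le one_lt_two (Nat.cast_pos.2 (NeZero.pos L))).2 hL
  have hn' : (0 : ℝ) < n := Nat.cast_pos.2 hn
  have h2 : max 0 (n * meanInfo (fun s : V' × U => pU s.2 * p' s.2 s.1) (fun s => p s.2)
      (fun s v => A v s.1) - Real.logb 2 L) ≤ n * (2 * δ) := by
    refine max_le (by positivity) ?_
    linarith
  linarith

/-- Achievability strictly below `I(V_t;Y_t|U)`: some pair of codebooks of the random ensemble has
small error probabilities and small leakage rates for both users at once. -/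
theorem isAchievable_of_lt (hpU : pU ∈ stdSimplex ℝ U) (hp₁ : ∀ u, p₁ u ∈ stdSimplex ℝ V₁)
    (hp₂ : ∀ u, p₂ u ∈ stdSimplex ℝ V₂) (hq₁ : ∀ v, q₁ v ∈ stdSimplex ℝ X₁)
    (hq₂ : ∀ v, q₂ v ∈ stdSimplex ℝ X₂) (hW : IsChannel W) {R₁ R₂ : ℝ} (hR₁ : 0 ≤ R₁)
    (hR₂ : 0 ≤ R₂)
    (h₁ : R₁ ≤ meanInfo pU p₁ (averagedKernel p₂ (auxChannel₁ q₁ q₂ W)) -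
      meanInfo (fun s : V₂ × U => pU s.2 * p₂ s.2 s.1) (fun s => p₁ s.2)
        (fun s v => auxChannel₂ q₁ q₂ W v s.1))
    (h₂ : R₂ ≤ meanInfo pU p₂ (averagedKernel p₁ fun v₂ v₁ => auxChannel₂ q₁ q₂ W v₁ v₂) -
      meanInfo (fun s : V₁ × U => pU s.2 * p₁ s.2 s.1) (fun s => p₂ s.2)
        (fun s v => auxChannel₁ q₁ q₂ W s.1 v))
    (h₁' : R₁ = 0 ∨ R₁ < meanInfo pU p₁ (averagedKernel p₂ (auxChannel₁ q₁ q₂ W)))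
    (h₂' : R₂ = 0 ∨
      R₂ < meanInfo pU p₂ (averagedKernel p₁ fun v₂ v₁ => auxChannel₂ q₁ q₂ W v₁ v₂)) :
    IsAchievable W R₁ R₂ := by
  refine ⟨hR₁, hR₂, fun ε hε => ?_⟩
  obtain ⟨δ₁, hδ₁, hsize₁⟩ := exists_codebook_size_le hR₁ h₁ h₁'
  obtain ⟨δ₂, hδ₂, hsize₂⟩ := exists_codebook_size_le hR₂ h₂ h₂'
  -- channels to the intended receivers and, for the other user's codeword known, to the other ones
  set A₁ : V₁ → V₂ → Y₁ → ℝ := auxChannel₁ q₁ q₂ W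
  set A₂ : V₂ → V₁ → Y₂ → ℝ := fun v₂ v₁ => auxChannel₂ q₁ q₂ W v₁ v₂
  set B₁ : V₁ → V₂ → Y₂ → ℝ := auxChannel₂ q₁ q₂ W
  set B₂ : V₂ → V₁ → Y₁ → ℝ := fun v₂ v₁ => auxChannel₁ q₁ q₂ W v₁ v₂
  have hA₁ : ∀ v₁ v₂, A₁ v₁ v₂ ∈ stdSimplex ℝ Y₁ := auxChannel₁_mem hq₁ hq₂ hW
  have hA₂ : ∀ v₂ v₁, A₂ v₂ v₁ ∈ stdSimplex ℝ Y₂ := fun v₂ v₁ => auxChannel₂_mem hq₁ hq₂ hW v₁ v₂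
  have hB₁ : ∀ v₁ v₂, B₁ v₁ v₂ ∈ stdSimplex ℝ Y₂ := auxChannel₂_mem hq₁ hq₂ hW
  have hB₂ : ∀ v₂ v₁, B₂ v₂ v₁ ∈ stdSimplex ℝ Y₁ := fun v₂ v₁ => auxChannel₁_mem hq₁ hq₂ hW v₁ v₂
  set I₁ := meanInfo pU p₁ (averagedKernel p₂ A₁)
  set I₂ := meanInfo pU p₂ (averagedKernel p₁ A₂)
  set S₁ := meanInfo (fun s : V₂ × U => pU s.2 * p₂ s.2 s.1) (fun s => p₁ s.2)
    (fun s v => B₁ v s.1)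
  set S₂ := meanInfo (fun s : V₁ × U => pU s.2 * p₁ s.2 s.1) (fun s => p₂ s.2)
    (fun s v => B₂ v s.1)
  obtain ⟨δ, hδ, hδε, hδ1, hδ2⟩ : ∃ δ : ℝ, 0 < δ ∧ δ ≤ ε / 10 ∧ δ ≤ δ₁ ∧ δ ≤ δ₂ :=
    ⟨min (ε / 10) (min δ₁ δ₂), by positivity, min_le_left _ _,
      (min_le_right _ _).trans (min_le_left _ _), (min_le_right _ _).trans (min_le_right _ _)⟩
  set v₁ := varInfo pU p₁ (averagedKernel p₂ A₁)
  set v₂ := varInfo pU p₂ (averagedKernel p₁ A₂)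
  set s₁ := varInfo (fun s : V₂ × U => pU s.2 * p₂ s.2 s.1) (fun s => p₁ s.2)
    (fun s v => B₁ v s.1)
  set s₂ := varInfo (fun s : V₁ × U => pU s.2 * p₁ s.2 s.1) (fun s => p₂ s.2)
    (fun s v => B₂ v s.1)
  obtain ⟨n, hn, hnε⟩ := exists_block_length ((v₁ + v₂) / δ ^ 2 + (s₁ + s₂) / (2 * δ) + 2) hδ
    (half_pos hε)
  have hn' : (0 : ℝ) < n := Nat.cast_pos.2 hn
  obtain ⟨M₁, hM₁⟩ : ∃ M : ℕ, M = ⌈(2 : ℝ) ^ (n * R₁)⌉₊ := ⟨_, rfl⟩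
  obtain ⟨M₂, hM₂⟩ : ∃ M : ℕ, M = ⌈(2 : ℝ) ^ (n * R₂)⌉₊ := ⟨_, rfl⟩
  obtain ⟨L₁, hL₁⟩ : ∃ L : ℕ, L = ⌈(2 : ℝ) ^ (n * (S₁ - 2 * δ))⌉₊ := ⟨_, rfl⟩
  obtain ⟨L₂, hL₂⟩ : ∃ L : ℕ, L = ⌈(2 : ℝ) ^ (n * (S₂ - 2 * δ))⌉₊ := ⟨_, rfl⟩
  have : NeZero M₁ := ⟨hM₁ ▸ (Nat.ceil_pos.2 (by positivity)).ne'⟩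
  have : NeZero M₂ := ⟨hM₂ ▸ (Nat.ceil_pos.2 (by positivity)).ne'⟩
  have : NeZero L₁ := ⟨hL₁ ▸ (Nat.ceil_pos.2 (by positivity)).ne'⟩
  have : NeZero L₂ := ⟨hL₂ ▸ (Nat.ceil_pos.2 (by positivity)).ne'⟩
  have hRM₁ : (2 : ℝ) ^ (n * R₁) ≤ M₁ := hM₁ ▸ Nat.le_ceil _
  have hRM₂ : (2 : ℝ) ^ (n * R₂) ≤ M₂ := hM₂ ▸ Nat.le_ceil _
  let code : (Fin n → U) → (Fin M₁ × Fin L₁ → Fin n → V₁) → (Fin M₂ × Fin L₂ → Fin n → V₂) →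
      Code X₁ X₂ Y₁ Y₂ n M₁ M₂ := fun u C₁ C₂ => codebookCode hq₁ hq₂ C₁ C₂
    (rateDecoder p₁ p₂ A₁ (I₁ - δ) u C₁) (rateDecoder p₂ p₁ A₂ (I₂ - δ) u C₂)
  -- error probabilities and leakage rates add up to a nonnegative quantity with a small mean
  have hmean : codebookMean pU p₁ p₂ (fun u C₁ C₂ =>
      ((code u C₁ C₂).error₁ W + (code u C₁ C₂).error₂ W) +
      ((Real.logb 2 M₁ - (code u C₁ C₂).equivocation₁ W) +
        (Real.logb 2 M₂ - (code u C₁ C₂).equivocation₂ W)) / n) ≤ ε := by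
    have hE₁ := codebookMean_error_le_of_card (J := Fin M₁ × Fin L₁) (J' := Fin M₂ × Fin L₂)
      hpU hp₁ hp₂ hA₁ hδ hn (by
        have := hsize₁ δ hδ hδ1 n
        simpa [hM₁, hL₁] using this)
    have hE₂ := codebookMean_error_le_of_card (J := Fin M₂ × Fin L₂) (J' := Fin M₁ × Fin L₁)
      hpU hp₂ hp₁ hA₂ hδ hn (by
        have := hsize₂ δ hδ hδ2 n
        simpa [hM₂, hL₂] using this)
    have hD₁ := codebookMean_divergence_le_of_le (J' := Fin M₂ × Fin L₂) (M := M₁) (L := L₁)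
      hpU hp₁ hp₂ hB₁ hδ hn (hL₁ ▸ Nat.le_ceil _)
    have hD₂ := codebookMean_divergence_le_of_le (J' := Fin M₁ × Fin L₁) (M := M₂) (L := L₂)
      hpU hp₂ hp₁ hB₂ hδ hn (hL₂ ▸ Nat.le_ceil _)
    rw [codebookMean_comm] at hE₂ hD₂
    refine (codebookMean_mono hpU hp₁ hp₂ (G := fun u C₁ C₂ =>
      (codebookError A₁ (rateDecoder p₁ p₂ A₁ (I₁ - δ) u C₁) C₁ C₂ +
        codebookError A₂ (rateDecoder p₂ p₁ A₂ (I₂ - δ) u C₂) C₂ C₁) +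
      (codebookDivergence p₁ B₁ u C₁ C₂ + codebookDivergence p₂ B₂ u C₂ C₁) / n)
      fun u C₁ C₂ hC₁ hC₂ => ?_).trans ?_
    · refine add_le_add (add_le_add (error₁_codebookCode_le hW) (error₂_codebookCode_le hW))
        (div_le_div_of_nonneg_right (add_le_add ?_ ?_) hn'.le)
      · exact logb_sub_condEntropy_le_codebookDivergence hp₁ hB₁ hC₁ law_jointLaw₁
      · exact logb_sub_condEntropy_le_codebookDivergence hp₂ hB₂ hC₂ law_jointLaw₂
    · rw [codebookMean_add, codebookMean_add, codebookMean_div, codebookMean_add]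
      have hD := div_le_div_of_nonneg_right (add_le_add hD₁ hD₂) hn'.le
      have hsplit : (v₁ / (n * δ ^ 2) + 4 * 2 ^ (-(n * δ))) +
          (v₂ / (n * δ ^ 2) + 4 * 2 ^ (-(n * δ))) +
          ((1 + s₁ / (2 * δ) + n * (5 / 2 * δ)) + (1 + s₂ / (2 * δ) + n * (5 / 2 * δ))) / n =
          (((v₁ + v₂) / δ ^ 2 + (s₁ + s₂) / (2 * δ) + 2) / n + 8 * 2 ^ (-(n * δ))) + 5 * δ := by
        field_simp
        ring
      linarith
  obtain ⟨u, C₁, C₂, hC⟩ := exists_le_of_codebookMean_le hpU hp₁ hp₂ hmean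
  have he₁ := error₁_nonneg hW (code u C₁ C₂)
  have he₂ := error₂_nonneg hW (code u C₁ C₂)
  have hl₁ : 0 ≤ Real.logb 2 M₁ - (code u C₁ C₂).equivocation₁ W :=
    sub_nonneg.2 (condEntropy_le_logb (jointLaw_mem hW) _ _)
  have hl₂ : 0 ≤ Real.logb 2 M₂ - (code u C₁ C₂).equivocation₂ W :=
    sub_nonneg.2 (condEntropy_le_logb (jointLaw_mem hW) _ _)
  have hl₁' := div_nonneg hl₁ hn'.le
  have hl₂' := div_nonneg hl₂ hn'.le
  rw [add_div] at hC
  have hrate₁ := (Real.le_logb_iff_rpow_le one_lt_two (Nat.cast_pos.2 (NeZero.pos M₁))).2 hRM₁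
  have hrate₂ := (Real.le_logb_iff_rpow_le one_lt_two (Nat.cast_pos.2 (NeZero.pos M₂))).2 hRM₂
  refine ⟨n, M₁, M₂, code u C₁ C₂, hn, hRM₁, hRM₂, max_le (by linarith) (by linarith), ?_, ?_⟩
  · have h : (Real.logb 2 M₁ - (code u C₁ C₂).equivocation₁ W) / n ≤ ε := by linarith
    rw [div_le_iff₀ hn'] at h
    linarith
  · have h : (Real.logb 2 M₂ - (code u C₁ C₂).equivocation₂ W) / n ≤ ε := by linarith
    rw [div_le_iff₀ hn'] at h
    linarith

end Achievability

end ICCM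

theorem theorem2 {X₁ X₂ Y₁ Y₂ U V₁ V₂ : Type*}
    [Fintype X₁] [Fintype X₂] [Fintype Y₁] [Fintype Y₂] [Fintype U] [Fintype V₁] [Fintype V₂]
    (W : X₁ → X₂ → Y₁ × Y₂ → ℝ) (hW : ICCM.IsChannel W)
    (P : U × V₁ × V₂ × X₁ × X₂ × Y₁ × Y₂ → ℝ) (hP : P ∈ ICCM.inputClass U V₁ V₂ W)
    (R₁ R₂ : ℝ) (hR₁ : 0 ≤ R₁) (hR₂ : 0 ≤ R₂)
    (h₁ : R₁ ≤ ICCM.condMutualInfo P ICCM.rvV₁ ICCM.rvY₁ ICCM.rvU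
      - ICCM.condMutualInfo P ICCM.rvV₁ ICCM.rvY₂ (fun ω => (ICCM.rvV₂ ω, ICCM.rvU ω)))
    (h₂ : R₂ ≤ ICCM.condMutualInfo P ICCM.rvV₂ ICCM.rvY₂ ICCM.rvU
      - ICCM.condMutualInfo P ICCM.rvV₂ ICCM.rvY₁ (fun ω => (ICCM.rvV₁ ω, ICCM.rvU ω))) :
    -- every pair of the region is achievable, except possibly at the extreme boundary
    -- `0 < R_t = I(V_t; Y_t | U)`
    ((R₁ = 0 ∨ R₁ < ICCM.condMutualInfo P ICCM.rvV₁ ICCM.rvY₁ ICCM.rvU) →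
      (R₂ = 0 ∨ R₂ < ICCM.condMutualInfo P ICCM.rvV₂ ICCM.rvY₂ ICCM.rvU) →
        ICCM.IsAchievable W R₁ R₂) ∧
    -- and every pair of the region is in the capacity region
    (R₁, R₂) ∈ ICCM.capacityRegion W := by
  obtain ⟨pU, p₁, p₂, q₁, q₂, hpU, hp₁, hp₂, hq₁, hq₂, hP⟩ := hP
  rw [ICCM.condMutualInfo_intended₁ hp₁ hp₂ hq₁ hq₂ hW hP, ICCM.condMutualInfo_penalty₁ hp₁ hq₁ hq₂ hW hP] at h₁
  rw [ICCM.condMutualInfo_intended₂ hp₁ hp₂ hq₁ hq₂ hW hP, ICCM.condMutualInfo_penalty₂ hp₂ hq₁ hq₂ hW hP] at h₂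
  rw [ICCM.condMutualInfo_intended₁ hp₁ hp₂ hq₁ hq₂ hW hP, ICCM.condMutualInfo_intended₂ hp₁ hp₂ hq₁ hq₂ hW hP]
  refine ⟨ICCM.isAchievable_of_lt hpU hp₁ hp₂ hq₁ hq₂ hW hR₁ hR₂ h₁ h₂, ?_⟩
  have hS₁ : 0 ≤ ICCM.meanInfo (fun s : V₂ × U => pU s.2 * p₂ s.2 s.1) (fun s => p₁ s.2)
      (fun s v => ICCM.auxChannel₂ q₁ q₂ W v s.1) :=
    ICCM.meanInfo_nonneg (ICCM.mul_mem_stdSimplex hpU hp₂) (fun s => hp₁ s.2)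
      fun s v => ICCM.auxChannel₂_mem hq₁ hq₂ hW v s.1
  have hS₂ : 0 ≤ ICCM.meanInfo (fun s : V₁ × U => pU s.2 * p₁ s.2 s.1) (fun s => p₂ s.2)
      (fun s v => ICCM.auxChannel₁ q₁ q₂ W s.1 v) :=
    ICCM.meanInfo_nonneg (ICCM.mul_mem_stdSimplex hpU hp₁) (fun s => hp₂ s.2)
      fun s v => ICCM.auxChannel₁_mem hq₁ hq₂ hW s.1 v
  -- the pairs `((1 - t) R₁, (1 - t) R₂)` with `0 < t < 1` are achievable
  have hscale : ∀ {R I S : ℝ}, 0 ≤ R → R ≤ I - S → 0 ≤ S → ∀ {t : ℝ}, t ∈ Set.Ioo (0 : ℝ) 1 →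
      0 ≤ (1 - t) * R ∧ (1 - t) * R ≤ I - S ∧ ((1 - t) * R = 0 ∨ (1 - t) * R < I) := by
    intro R I S hR h hS t ht
    have h1 : 0 ≤ t * R := mul_nonneg ht.1.le hR
    refine ⟨mul_nonneg (by linarith [ht.2]) hR, by linarith, ?_⟩
    rcases hR.eq_or_lt with rfl | hR
    · exact Or.inl (mul_zero _)
    · have h2 : 0 < t * R := mul_pos ht.1 hR
      exact Or.inr (by linarith)
  have hlim : Filter.Tendsto (fun t : ℝ => ((1 - t) * R₁, (1 - t) * R₂))
      (nhdsWithin 0 (Set.Ioi 0)) (nhds (R₁, R₂)) := by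
    have hc : Continuous fun t : ℝ => ((1 - t) * R₁, (1 - t) * R₂) := by fun_prop
    simpa using (hc.tendsto 0).mono_left nhdsWithin_le_nhds
  refine mem_closure_of_tendsto hlim ?_
  filter_upwards [Ioo_mem_nhdsGT (zero_lt_one' ℝ)] with t ht
  obtain ⟨ha₁, hb₁, hc₁⟩ := hscale hR₁ h₁ hS₁ ht
  obtain ⟨ha₂, hb₂, hc₂⟩ := hscale hR₂ h₂ hS₂ ht
  exact ICCM.isAchievable_of_lt hpU hp₁ hp₂ hq₁ hq₂ hW ha₁ ha₂ hb₁ hb₂ hc₁ hc₂
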